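/- For real $a>0$, $z\ge 0$ and $0\le\alpha<1$ let $$\mathrm{Ci}(a,z)=\int_0^z t^{a-1}\cos t\,dt,\qquad \mathrm{Si}(a,z)=\int_0^z t^{a-1}\sin t\,dt,\qquad \mathrm{Ti}(a,z,\alpha)=\mathrm{Ci}(a,z)\cos(\pi\alpha)+\mathrm{Si}(a,z)\sin(\pi\alpha).$$ Define rational functions $F_s$ ($s\ge 0$) by $F_0(z)=-\frac{z}{(z-1)^2}$, $F_1(z)=-\frac{2z(z+1)}{(z-1)^4}$ and $$F_{s+1}(z)=\frac{z}{1-z}F_s'(z)-\frac12\sum_{j=0}^{s}F_j(z)F_{s-j}(z)\qquad(s\ge 1),$$ and for $s\ge 1$ put $$E_s(z)=\int_0^z\frac{(t-1)F_s(t)}{2t}\,dt,\qquad L_s(\theta)=(-1)^s\,\mathrm{Im}\,E_s(-i\theta)\quad(\theta\in\mathbb R),$$ the integral being taken along the segment from $0$ to $z$. Let $B_{n,j}(x_1,\dots,x_{n-j+1})$ be the partial Bell polynomials. Define functions $q_k$ ($k\ge 2$) of a real variable $x$ by $$q_2(x)=\frac{x(x^2-1)}{(x^2+1)^2},\qquad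 q_3(x)=\frac{q_2(x)}{x^2+1}-L_2(x),$$ and, for $k\ge 4$, $$q_k(x)=\frac{1}{(k-1)!}\sum_{j=1}^{k-1}\frac{d^{j-1}}{dx^{j-1}}\Big(\frac1{x^2+1}\Big)B_{k-1,j}\big(0,2!q_2(x),\dots,(k-j)!q_{k-j}(x)\big)$$ $$\qquad-\sum_{s=1}^{k-2}\sum_{j=1}^{k-s-1}\frac{1}{(k-s-1)!}L_s^{(j)}(x)\,B_{k-s-1,j}\big(0,2!q_2(x),\dots,(k-s-j)!q_{k-s-j}(x)\big)-L_{k-1}(x).$$ Then every $q_k$ ($k\ge2$) is a rational function of $x$ without real poles, it vanishes at $x=0$ and as $x\to\pm\infty$, and $$q_3(x)=\frac{4x^3(2x^2-3)}{(x^2+1)^4},\qquad q_4(x)=-\frac{2x^3(8x^6-183x^4+336x^2-65)}{3(x^2+1)^6},$$ $$q_5(x)=-\frac{x^3(679x^8-8384x^6+17226x^4-7168x^2+431)}{3(x^2+1)^8}.$$ Moreover, for all sufficiently large real $a$, the positive zeros $\theta$ of $\mathrm{Ci}(a,a\theta)$ form an infinite increasing sequence $c_1<c_2<\cdots$, for each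 $m\ge1$ the equation $$a\,c_{m,0}-\arctan(c_{m,0})=(m-\tfrac12)\pi$$ has exactly one positive root $c_{m,0}$, and $$c_m\sim c_{m,0}+\sum_{k=2}^\infty\frac{q_k(c_{m,0})}{a^k}\qquad(a\to\infty)$$ uniformly in $m\ge1$; that is, for every $n\ge1$ there are constants $C,A$, independent of $m$ and $a$, such that $$\Big|c_m-c_{m,0}-\sum_{k=2}^n\frac{q_k(c_{m,0})}{a^k}\Big|\le\frac{C}{a^{n+1}}\qquad(a\ge A,\ m=1,2,3,\dots).$$ The same holds, with the same functions $q_k$, for the positive zeros $s_1<s_2<\cdots$ of $\mathrm{Si}(a,a\theta)$, the leading term $s_{m,0}$ being the unique positive root of $a\,s_{m,0}-\arctan(s_{m,0})=m\pi$, and, for each fixed $\alpha\in[0,1)$, for the positive zeros $t_1<t_2<\cdots$ of $\mathrm{Ti}(a,a\theta,\alpha)$, the leading term $t_{m,0}$ being the unique positive root of $$a\,t_{m,0}-\arctan(t_{m,0})=(m-l+\alpha-\tfrac12)\pi,$$ where $l=0$ if $0\le\alpha\le\frac12$ and $l=1$ if $\frac12<\alpha<1$ (the constants $C,A$ may depend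 on $\alpha$ and $n$). -/

import Mathlib

namespace GTI

/-- The generalised cosine integral `Ci(a, z) = ∫₀ᶻ t^(a-1) cos t dt` (used for real `a > 0`, `z ≥ 0`). -/
noncomputable def Ci (a z : ℝ) : ℝ := ∫ t in (0 : ℝ)..z, t ^ (a - 1) * Real.cos t

/-- The generalised sine integral `Si(a, z) = ∫₀ᶻ t^(a-1) sin t dt` (used for real `a > 0`, `z ≥ 0`). -/
noncomputable def Si (a z : ℝ) : ℝ := ∫ t in (0 : ℝ)..z, t ^ (a - 1) * Real.sin t

/-- `Ti(a, z, α) = Ci(a, z) cos(πα) + Si(a, z) sin(πα)`. -/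
noncomputable def Ti (a z α : ℝ) : ℝ :=
  Ci a z * Real.cos (Real.pi * α) + Si a z * Real.sin (Real.pi * α)

/-- The Liouville-Green coefficients `F⁻ₛ(z)`. -/
noncomputable def lgF : ℕ → ℂ → ℂ
  | 0 => fun z => -z / (z - 1) ^ 2
  | 1 => fun z => -(2 * z * (z + 1)) / (z - 1) ^ 4
  | s + 2 => fun z =>
      z / (1 - z) * deriv (lgF (s + 1)) z
        - 1 / 2 * ∑ j : Fin (s + 2), lgF j.val z * lgF (s + 1 - j.val) z
  decreasing_by all_goals omega

/-- `E⁻ₛ(z) = ∫₀ᶻ (t - 1) F⁻ₛ(t) / (2 t) dt`, the integral being taken along the straight segment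
`t = u z`, `0 ≤ u ≤ 1`. The integrand has a removable singularity at `t = 0`. -/
noncomputable def lgE (s : ℕ) (z : ℂ) : ℂ :=
  z * ∫ u in (0 : ℝ)..1,
    ((u : ℂ) * z - 1) * lgF s ((u : ℂ) * z) / (2 * ((u : ℂ) * z))

/-- `Lₛ(θ) = (-1)ˢ Im E⁻ₛ(-iθ)`. -/
noncomputable def L (s : ℕ) (θ : ℝ) : ℝ := (-1) ^ s * (lgE s (-(Complex.I * (θ : ℂ)))).im

/-- The partial Bell polynomial `B_{n,j}(x₁, x₂, …)`, defined by its exponential generating function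
`(1 / j!) (∑_{i ≥ 1} xᵢ tⁱ / i!)ʲ = ∑_{n} B_{n,j}(x₁, x₂, …) tⁿ / n!`.
It depends on `x₁, …, x_{n-j+1}` only. -/
noncomputable def bellB (n j : ℕ) (x : ℕ → ℝ) : ℝ :=
  (n.factorial : ℝ) / (j.factorial : ℝ) *
    PowerSeries.coeff n
      ((PowerSeries.mk fun i => if i = 0 then 0 else x i / (i.factorial : ℝ)) ^ j)

/-- The coefficient functions `q_k`, `k ≥ 2`, with the convention `q_0 = q_1 = 0`. For `k ≥ 4` they
are given recursively by the Faà di Bruno formula; here `k = n + 4`, and the arguments of the Bell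
polynomials are `xᵢ = i! qᵢ(x)`, so that `x₁ = 0`. -/
noncomputable def q : ℕ → ℝ → ℝ
  | 0 => fun _ => 0
  | 1 => fun _ => 0
  | 2 => fun x => x * (x ^ 2 - 1) / (x ^ 2 + 1) ^ 2
  | 3 => fun x => q 2 x / (x ^ 2 + 1) - L 2 x
  | n + 4 => fun x =>
      let k := n + 4
      let args : ℕ → ℝ := fun i => if i < n + 4 then (i.factorial : ℝ) * q i x else 0
      1 / ((k - 1).factorial : ℝ) *
          ∑ j ∈ Finset.Icc 1 (k - 1),
            iteratedDeriv (j - 1) (fun y : ℝ => 1 / (y ^ 2 + 1)) x * bellB (k - 1) j args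
        - ∑ s ∈ Finset.Icc 1 (k - 2), ∑ j ∈ Finset.Icc 1 (k - s - 1),
            1 / ((k - s - 1).factorial : ℝ) * iteratedDeriv j (L s) x * bellB (k - s - 1) j args
        - L (k - 1) x
  decreasing_by all_goals omega

/-- `z 1 < z 2 < z 3 < ⋯` are exactly the positive zeros of `g`, so `z m` is the `m`-th one. -/
def IsPositiveZeroEnumeration (g : ℝ → ℝ) (z : ℕ → ℝ) : Prop :=
  StrictMonoOn z (Set.Ici 1) ∧ z '' Set.Ici 1 = {θ : ℝ | 0 < θ ∧ g θ = 0}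

/-- For all large `a` the positive zeros of `g a` form an increasing sequence `z a 1 < z a 2 < ⋯`,
the equation `a x - arctan x = μ m` has exactly one positive root `z₀ a m` for every `m ≥ 1`, and
`z a m ∼ z₀ a m + ∑_{k ≥ 2} r k (z₀ a m) / a ^ k` as `a → ∞`, uniformly in `m ≥ 1`: the remainder
after the term with index `n` is at most `C / a ^ (n + 1)` for `a ≥ A`, where `C` and `A` depend on
`n` but not on `a` and `m`. -/
def HasUniformZeroExpansion (g : ℝ → ℝ → ℝ) (μ : ℕ → ℝ) (r : ℕ → ℝ → ℝ) : Prop :=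
  ∃ (a₀ : ℝ) (z z₀ : ℝ → ℕ → ℝ),
    (∀ a ≥ a₀, IsPositiveZeroEnumeration (g a) (z a)) ∧
    (∀ a ≥ a₀, ∀ m ≥ 1, {x : ℝ | 0 < x ∧ a * x - Real.arctan x = μ m} = {z₀ a m}) ∧
    ∀ n ≥ 1, ∃ C A : ℝ, ∀ a ≥ A, ∀ m ≥ 1,
      |z a m - (z₀ a m + ∑ k ∈ Finset.Icc 2 n, r k (z₀ a m) / a ^ k)| ≤ C / a ^ (n + 1)

end GTI

namespace GTI

open Polynomial

/-! Put `cis a θ` = Ci(a, aθ) + i Si(a, aθ). Its derivative is a (aθ)^(a-1) exp(iaθ), so U = θ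
cis'/cis equals (aθ)^a exp(iaθ)/cis. Writing U = a(1 + iθ) + V turns θU' = U(a(1 + iθ) - U) into the
Riccati equation θV' + V² + a(1 + iθ)V + iaθ = 0. In the variable p = 1/(1 + iθ) the operator θ d/dθ
is p(p - 1) d/dp, so the formal solution in powers of 1/a has polynomial coefficients `riccati s` in
p. They are the Liouville-Green coefficients in disguise (`lgF_eq`), and the imaginary part of the
s-th one divided by θ is the derivative of L_s (`hasDerivAt_L`).

Truncating V leaves a small defect in the Riccati equation (`exists_riccati_remainder_le`), and a
barrier argument started at θ = 0 converts it into a bound for `cis` itself (`exists_cis_sub_le`).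
Divided by its leading approximation, `cis` stays within 1/2 of 1 (`exists_ratio_estimate`), so its
phase is aθ - arctan θ plus a small smooth `phaseShift`. The derivative of `phaseShift` is known up
to O(1/(1 + θ²)) times a power of 1/a. This weight is integrable, so `phaseShift` has the expansion
Σ L_s(θ)/a^s uniformly on θ > 0 (`exists_phaseShift_expansion`).

Ti is the real part of exp(-iπα) `cis`, so its zeros are the points where the phase is an odd
multiple of π/2 shifted by πα. The phase increases from 0 with slope at least a/2, hence takes each
positive value once. The m-th zero θ therefore solves phase(θ) = a x - arctan x, where x is the
leading term. Inserting θ = x + Σ q_k(x)/a^k and comparing powers of 1/a gives exactly the recursion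
for q_k (`coeff_residual`). The truncated sum satisfies the equation up to O(a^(-n)), and division
by the slope yields O(a^(-n-1)) (`exists_abs_sub_qPoly_le`).

Uniformity in m is uniformity in x: every function involved lies in the algebra generated by 1/(x² +
1) and x/(x² + 1), which is closed under differentiation and consists of bounded functions. Ci and
Si are the cases α = 0 and α = 1/2. -/

/-! ### Riccati coefficients and their relation to F_s, E_s and L_s. -/

/-- The coefficients of the expansion in powers of `1 / a` of the logarithmic derivative
`ζ I' / I`, `I = ∫₀¹ v ^ (a - 1) exp (a ζ (1 - v)) dv`, as polynomials in `p = 1 / (1 - ζ)`. -/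
noncomputable def riccati : ℕ → ℝ[X]
  | 0 => X - 1
  | s + 1 => -(X * (X * (X - 1) * derivative (riccati s)
      + ∑ j : Fin (s + 1), riccati j.val * riccati (s - j.val)))
  decreasing_by all_goals omega

lemma riccati_zero : riccati 0 = X - 1 := by rw [riccati]

lemma riccati_succ (s : ℕ) : riccati (s + 1) = -(X * (X * (X - 1) * derivative (riccati s)
    + ∑ j ∈ Finset.range (s + 1), riccati j * riccati (s - j))) := by
  rw [riccati, Finset.sum_range]

/-- The factor X - 1 encodes vanishing at θ = 0, since p - 1 = -iθp. The recursion preserves it. -/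
lemma X_sub_one_dvd_riccati (s : ℕ) : (X - 1 : ℝ[X]) ∣ riccati s := by
  induction s using Nat.strong_induction_on with
  | _ s ih =>
    rcases s with _ | s
    · rw [riccati_zero]
    · rw [riccati_succ, dvd_neg]
      refine Dvd.dvd.mul_left (dvd_add ((dvd_mul_left _ _).mul_right _) ?_) _
      exact Finset.dvd_sum fun j hj => (ih j (Finset.mem_range.mp hj)).mul_right _

/-- From the first correction on there is also a factor X, that is, one more power of decay as θ →
∞. It makes a polynomial primitive possible and errors integrable on (0, ∞). -/
lemma X_mul_X_sub_one_dvd_riccati_succ (s : ℕ) :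
    (X * (X - 1) : ℝ[X]) ∣ riccati (s + 1) := by
  rw [riccati_succ, dvd_neg]
  refine mul_dvd_mul_left _ (dvd_add ((dvd_mul_left _ _).mul_right _) ?_)
  exact Finset.dvd_sum fun j hj => (X_sub_one_dvd_riccati j).mul_right _

lemma X_mul_X_sub_one_dvd_riccati_mul {i j : ℕ} (h : 0 < i + j) :
    (X * (X - 1) : ℝ[X]) ∣ riccati i * riccati j := by
  rcases i with _ | i
  · obtain ⟨j, rfl⟩ := Nat.exists_eq_succ_of_ne_zero (show j ≠ 0 by omega)
    exact (X_mul_X_sub_one_dvd_riccati_succ j).mul_left _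
  · exact (X_mul_X_sub_one_dvd_riccati_succ i).mul_right _

/-- The polynomial here is `-riccati (s + 1) / X`. -/
lemma X_mul_X_sub_one_dvd_riccati_step {s : ℕ} (h : 0 < s) :
    (X * (X - 1) : ℝ[X]) ∣ X * (X - 1) * derivative (riccati s)
      + ∑ j ∈ Finset.range (s + 1), riccati j * riccati (s - j) := by
  refine dvd_add (dvd_mul_right _ _) (Finset.dvd_sum fun j hj => ?_)
  apply X_mul_X_sub_one_dvd_riccati_mul
  have := Finset.mem_range.mp hj
  omega

lemma exists_derivative_eq (R : ℝ[X]) : ∃ E : ℝ[X], derivative E = R := by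
  induction R using Polynomial.induction_on' with
  | add f g hf hg =>
    obtain ⟨F, rfl⟩ := hf
    obtain ⟨G, rfl⟩ := hg
    exact ⟨F + G, derivative_add⟩
  | monomial n c =>
    refine ⟨monomial (n + 1) (c / (n + 1)), ?_⟩
    rw [derivative_monomial, Nat.add_sub_cancel]
    congr 1
    push_cast
    field_simp

/-- `E` is the polynomial such that `(-1)ˢ Eₛ(z) = E (1 / (1 - z))`. -/
def IsPrimitive (s : ℕ) (E : ℝ[X]) : Prop :=
  riccati s = X * (X - 1) * derivative E ∧ E.eval 1 = 0

lemma exists_isPrimitive (s : ℕ) : ∃ E, IsPrimitive (s + 1) E := by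
  obtain ⟨R, hR⟩ := X_mul_X_sub_one_dvd_riccati_succ s
  obtain ⟨E, hE⟩ := exists_derivative_eq R
  exact ⟨E - C (E.eval 1), by simp [hR, hE], by simp⟩

/-- Relation between the Liouville-Green coefficients and the Riccati coefficients. -/
lemma lgF_eq (s : ℕ) : ∀ z : ℂ, z ≠ 1 →
    lgF (s + 1) z = 2 * (-1) ^ s * (1 - z)⁻¹ * aeval (1 - z)⁻¹ (riccati (s + 1)) := by
  induction s using Nat.strong_induction_on with
  | _ s ih =>
    intro z hz
    have hz' : 1 - z ≠ 0 := sub_ne_zero.mpr (Ne.symm hz)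
    have hz'' : z - 1 ≠ 0 := sub_ne_zero.mpr hz
    rcases s with _ | s
    · rw [lgF, riccati_succ, Finset.sum_range_one, riccati_zero]
      simp
      field_simp
      ring
    · have hd : HasDerivAt (lgF (s + 1))
          (2 * (-1) ^ s * ((1 - z)⁻¹ ^ 2) * aeval (1 - z)⁻¹ (riccati (s + 1))
            + 2 * (-1) ^ s * (1 - z)⁻¹ * (aeval (1 - z)⁻¹ (derivative (riccati (s + 1)))
              * ((1 - z)⁻¹ ^ 2))) z := by
        have hp : HasDerivAt (fun w : ℂ => (1 - w)⁻¹) ((1 - z)⁻¹ ^ 2) z := by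
          have := ((hasDerivAt_const z (1 : ℂ)).sub (hasDerivAt_id z)).inv hz'
          refine this.congr_deriv ?_
          simp
        have h1 := (hp.const_mul (2 * (-1) ^ s)).mul
          (((riccati (s + 1)).hasDerivAt_aeval ((1 - z)⁻¹)).comp z hp)
        refine h1.congr_of_eventuallyEq ?_
        filter_upwards [isOpen_ne.mem_nhds hz] with w hw
        exact ih s (by omega) w hw
      rw [lgF]
      beta_reduce
      -- The terms j = 0 and j = s + 1 are split off because F_0 is half of what the general formula
      -- would give at index 0.
      rw [hd.deriv, ← Finset.sum_range (fun j => lgF j z * lgF (s + 1 - j) z),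
        riccati_succ (s + 1), Finset.sum_range_succ, Finset.sum_range_succ',
        Finset.sum_range_succ (fun j => riccati j * riccati (s + 1 - j)),
        Finset.sum_range_succ' (fun j => riccati j * riccati (s + 1 - j))]
      have hsum : ∑ k ∈ Finset.range s, lgF (k + 1) z * lgF (s + 1 - (k + 1)) z
          = 4 * (-1) ^ (s + 1) * (1 - z)⁻¹ ^ 2 * aeval (1 - z)⁻¹
            (∑ k ∈ Finset.range s, riccati (k + 1) * riccati (s + 1 - (k + 1))) := by
        rw [map_sum, Finset.mul_sum]
        refine Finset.sum_congr rfl fun k hk => ?_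
        have hk' := Finset.mem_range.mp hk
        obtain ⟨l, rfl⟩ : ∃ l, s = k + 1 + l := ⟨s - (k + 1), by omega⟩
        have e : k + 1 + l + 1 - (k + 1) = l + 1 := by omega
        rw [e, ih k (by omega) z hz, ih l (by omega) z hz, map_mul]
        ring
      rw [hsum, Nat.sub_self, Nat.sub_zero, riccati_zero, lgF]
      rw [ih s (by omega) z hz]
      generalize hS : (∑ k ∈ Finset.range s, riccati (k + 1) * riccati (s + 1 - (k + 1))) = S
      simp only [map_neg, map_mul, map_add, map_sub, aeval_X, map_one]
      generalize aeval (1 - z)⁻¹ S = S'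
      generalize aeval (1 - z)⁻¹ (derivative (riccati (s + 1))) = D'
      generalize aeval (1 - z)⁻¹ (riccati (s + 1)) = R'
      have e : z - 1 = -(1 - z) := by ring
      rw [e]
      field_simp
      ring

/-- `p θ = 1 / (1 + i θ)`. -/
noncomputable def p (θ : ℝ) : ℂ := (1 + θ * Complex.I)⁻¹

lemma one_add_mul_I_ne_zero (θ : ℝ) : (1 + θ * Complex.I : ℂ) ≠ 0 := by
  intro h
  have := congrArg Complex.re h
  simp at this

/-- Along t = uz the integrand, multiplied by z, is up to sign the u-derivative of E(1/(1 - uz)).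
The endpoint u = 0 contributes E(1) = 0. -/
lemma lgE_eq {s : ℕ} {E : ℝ[X]} (hE : IsPrimitive (s + 1) E) (θ : ℝ) :
    lgE (s + 1) (-(Complex.I * θ)) = (-1) ^ (s + 1) * aeval (p θ) E := by
  set z : ℂ := -(Complex.I * θ) with hz
  have hne : ∀ u : ℝ, 1 - u * z ≠ 0 := by
    intro u h
    have := congrArg Complex.re h
    simp [hz] at this
  have hderiv : ∀ u : ℝ, HasDerivAt (fun u : ℝ => (-1) ^ (s + 1) * aeval (1 - u * z)⁻¹ E)
      ((-1) ^ (s + 1) * (aeval (1 - u * z)⁻¹ (derivative E) * (z * (1 - u * z)⁻¹ ^ 2))) u := by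
    intro u
    have h0 : HasDerivAt (fun u : ℝ => 1 - (u : ℂ) * z) (-z) u := by
      have := ((hasDerivAt_id u).ofReal_comp.mul_const z).const_sub 1
      simpa using this
    have hp : HasDerivAt (fun u : ℝ => (1 - (u : ℂ) * z)⁻¹) (z * (1 - u * z)⁻¹ ^ 2) u := by
      refine (h0.inv (hne u)).congr_deriv ?_
      field_simp [hne u]
    exact ((E.hasDerivAt_aeval _).comp u hp).const_mul _
  have hint : ∫ u in (0 : ℝ)..1, z * (((u : ℂ) * z - 1) * lgF (s + 1) ((u : ℂ) * z)
        / (2 * ((u : ℂ) * z)))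
      = ∫ u in (0 : ℝ)..1,
        (-1) ^ (s + 1) * (aeval (1 - u * z)⁻¹ (derivative E) * (z * (1 - u * z)⁻¹ ^ 2)) := by
    -- The algebraic identity needs uz ≠ 0. For z ≠ 0 only u = 0 is lost, and it lies outside the
    -- half-open interval of integration.
    rcases eq_or_ne z 0 with h0 | h0
    · simp [h0]
    apply intervalIntegral.integral_congr_ae
    refine Filter.Eventually.of_forall fun u hu => ?_
    have hu0 : (u : ℂ) ≠ 0 := by
      rw [Set.uIoc_of_le zero_le_one] at hu
      exact_mod_cast hu.1.ne'
    have h1 : (u : ℂ) * z ≠ 1 := fun h => hne u (by rw [h, sub_self])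
    rw [lgF_eq s _ h1, hE.1]
    simp only [map_mul, map_sub, aeval_X, map_one]
    have h2 := hne u
    generalize aeval (1 - (u : ℂ) * z)⁻¹ (derivative E) = D
    have h3 : (u : ℂ) * z - 1 = -(1 - u * z) := by ring
    have h4 : (1 - (u : ℂ) * z)⁻¹ - 1 = u * z * (1 - u * z)⁻¹ := by field_simp; ring
    rw [h3, h4]
    field_simp
    ring
  rw [lgE, ← intervalIntegral.integral_const_mul, hint,
    intervalIntegral.integral_eq_sub_of_hasDerivAt (fun u _ => hderiv u)]
  · have h1 : aeval (1 : ℂ) E = 0 := by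
      have := aeval_algebraMap_apply ℂ (1 : ℝ) E
      rw [map_one] at this
      rw [this, coe_aeval_eq_eval, hE.2, map_zero]
    have h2 : 1 - ((1 : ℝ) : ℂ) * z = 1 + θ * Complex.I := by
      rw [hz]; push_cast; ring
    rw [h2]
    simp [h1, p]
  · apply Continuous.intervalIntegrable
    have hc : Continuous fun u : ℝ => (1 - (u : ℂ) * z)⁻¹ :=
      Continuous.inv₀ (by fun_prop) hne
    have := (derivative E).continuous_aeval (A := ℂ)
    fun_prop

lemma L_eq {s : ℕ} {E : ℝ[X]} (hE : IsPrimitive (s + 1) E) (θ : ℝ) :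
    L (s + 1) θ = (aeval (p θ) E).im := by
  have h : ((-1) ^ (s + 1) * aeval (p θ) E : ℂ) =
      (((-1) ^ (s + 1) : ℝ) : ℂ) * aeval (p θ) E := by push_cast; ring
  rw [L, lgE_eq hE, h, Complex.im_ofReal_mul, ← mul_assoc, ← mul_pow]
  norm_num

lemma p_mul (θ : ℝ) : (1 + θ * Complex.I) * p θ = 1 :=
  mul_inv_cancel₀ (one_add_mul_I_ne_zero θ)

lemma p_re (θ : ℝ) : (p θ).re = 1 / (θ ^ 2 + 1) := by
  simp [p, Complex.inv_re, Complex.normSq_apply]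
  ring

lemma p_im (θ : ℝ) : (p θ).im = -(θ / (θ ^ 2 + 1)) := by
  simp [p, Complex.inv_im, Complex.normSq_apply]
  ring

/-! ### A differentiation-stable algebra of bounded rational functions. -/

/-- The algebra of functions generated by the real and imaginary parts of `p`. -/
noncomputable def ratAlg : Subalgebra ℝ (ℝ → ℝ) :=
  Algebra.adjoin ℝ {fun x => 1 / (x ^ 2 + 1), fun x => x / (x ^ 2 + 1)}

lemma re_p_mem : (fun x : ℝ => 1 / (x ^ 2 + 1)) ∈ ratAlg := Algebra.subset_adjoin (by simp)

lemma im_p_mem : (fun x : ℝ => x / (x ^ 2 + 1)) ∈ ratAlg := Algebra.subset_adjoin (by simp)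

lemma const_mem (c : ℝ) : (fun _ : ℝ => c) ∈ ratAlg := ratAlg.algebraMap_mem c

lemma ratAlg_induction {P : (ℝ → ℝ) → Prop} {f : ℝ → ℝ} (hf : f ∈ ratAlg)
    (hu : P fun x => 1 / (x ^ 2 + 1)) (hv : P fun x => x / (x ^ 2 + 1))
    (hc : ∀ c : ℝ, P fun _ => c)
    (hadd : ∀ f g, f ∈ ratAlg → g ∈ ratAlg → P f → P g → P (f + g))
    (hmul : ∀ f g, f ∈ ratAlg → g ∈ ratAlg → P f → P g → P (f * g)) : P f := by
  induction hf using Algebra.adjoin_induction with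
  | mem x hx =>
    rcases hx with rfl | hx
    · exact hu
    · rw [Set.mem_singleton_iff] at hx
      exact hx ▸ hv
  | algebraMap r => exact hc r
  | add f g hf hg h1 h2 => exact hadd f g hf hg h1 h2
  | mul f g hf hg h1 h2 => exact hmul f g hf hg h1 h2

/-- Both generators are bounded by 1. This is the source of every bound that is uniform in the base
point, hence in m. -/
lemma exists_bound {f : ℝ → ℝ} (hf : f ∈ ratAlg) : ∃ C, 0 ≤ C ∧ ∀ x, |f x| ≤ C := by
  refine ratAlg_induction (P := fun f => ∃ C, 0 ≤ C ∧ ∀ x, |f x| ≤ C) hf ⟨1, zero_le_one, fun x => ?_⟩ ⟨1, zero_le_one, fun x => ?_⟩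
    (fun c => ⟨|c|, abs_nonneg c, fun _ => le_rfl⟩) ?_ ?_
  · rw [abs_of_pos (by positivity), div_le_one (by positivity)]
    nlinarith [sq_nonneg x]
  · rw [abs_div, abs_of_pos (show 0 < x ^ 2 + 1 by positivity), div_le_one (by positivity)]
    rw [abs_le]
    constructor <;> nlinarith [sq_nonneg (x - 1), sq_nonneg (x + 1)]
  · rintro f g - - ⟨C, hC, hf⟩ ⟨D, hD, hg⟩
    exact ⟨C + D, by positivity, fun x => (abs_add_le _ _).trans (add_le_add (hf x) (hg x))⟩
  · rintro f g - - ⟨C, hC, hf⟩ ⟨D, hD, hg⟩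
    refine ⟨C * D, by positivity, fun x => ?_⟩
    rw [Pi.mul_apply, abs_mul]
    exact mul_le_mul (hf x) (hg x) (abs_nonneg _) hC

lemma exists_hasDerivAt {f : ℝ → ℝ} (hf : f ∈ ratAlg) :
    ∃ g ∈ ratAlg, ∀ x, HasDerivAt f (g x) x := by
  refine ratAlg_induction (P := fun f => ∃ g ∈ ratAlg, ∀ x, HasDerivAt f (g x) x) hf ?_ ?_ (fun c => ⟨_, const_mem 0, fun x => hasDerivAt_const x c⟩) ?_ ?_
  · refine ⟨_, ratAlg.mul_mem (const_mem (-2)) (ratAlg.mul_mem re_p_mem im_p_mem), fun x => ?_⟩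
    have h := (((hasDerivAt_id x).pow 2).add_const 1).inv (show id x ^ 2 + 1 ≠ 0 by positivity)
    simp only [one_div]
    refine h.congr_deriv ?_
    have : x ^ 2 + 1 ≠ 0 := by positivity
    simp
    field_simp
  · refine ⟨_, ratAlg.sub_mem (ratAlg.mul_mem (const_mem 2) (ratAlg.mul_mem re_p_mem re_p_mem))
      re_p_mem, fun x => ?_⟩
    have h := (hasDerivAt_id x).div (((hasDerivAt_id x).pow 2).add_const 1)
      (show id x ^ 2 + 1 ≠ 0 by positivity)
    refine h.congr_deriv ?_
    have : x ^ 2 + 1 ≠ 0 := by positivity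
    simp
    field_simp
    ring
  · rintro f g - - ⟨f', hf', hf⟩ ⟨g', hg', hg⟩
    exact ⟨_, ratAlg.add_mem hf' hg', fun x => (hf x).add (hg x)⟩
  · rintro f g hfm hgm ⟨f', hf', hf⟩ ⟨g', hg', hg⟩
    exact ⟨_, ratAlg.add_mem (ratAlg.mul_mem hf' hgm) (ratAlg.mul_mem hfm hg'),
      fun x => (hf x).mul (hg x)⟩

lemma iteratedDeriv_mem {f : ℝ → ℝ} (hf : f ∈ ratAlg) (n : ℕ) : iteratedDeriv n f ∈ ratAlg := by
  induction n with
  | zero => rwa [iteratedDeriv_zero]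
  | succ n ih =>
    obtain ⟨g, hg, h⟩ := exists_hasDerivAt ih
    rwa [iteratedDeriv_succ, funext fun x => (h x).deriv]

lemma hasDerivAt_iteratedDeriv {f : ℝ → ℝ} (hf : f ∈ ratAlg) (n : ℕ) (x : ℝ) :
    HasDerivAt (iteratedDeriv n f) (iteratedDeriv (n + 1) f x) x := by
  obtain ⟨g, hg, h⟩ := exists_hasDerivAt (iteratedDeriv_mem hf n)
  rw [iteratedDeriv_succ]
  exact (h x).differentiableAt.hasDerivAt

lemma exists_eq_div {f : ℝ → ℝ} (hf : f ∈ ratAlg) :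
    ∃ (P : ℝ[X]) (n : ℕ), ∀ x, f x = P.eval x / (x ^ 2 + 1) ^ n := by
  refine ratAlg_induction
    (P := fun f => ∃ (P : ℝ[X]) (n : ℕ), ∀ x, f x = P.eval x / (x ^ 2 + 1) ^ n) hf ⟨1, 1, by simp⟩ ⟨X, 1, by simp⟩ (fun c => ⟨C c, 0, by simp⟩) ?_ ?_
  · rintro f g - - ⟨P, n, hf⟩ ⟨Q, m, hg⟩
    refine ⟨P * (X ^ 2 + 1) ^ m + Q * (X ^ 2 + 1) ^ n, n + m, fun x => ?_⟩
    have : x ^ 2 + 1 ≠ 0 := by positivity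
    simp [hf, hg]
    field_simp
    ring
  · rintro f g - - ⟨P, n, hf⟩ ⟨Q, m, hg⟩
    refine ⟨P * Q, n + m, fun x => ?_⟩
    have : x ^ 2 + 1 ≠ 0 := by positivity
    simp [hf, hg]
    field_simp
    ring

lemma tendsto_re_p : Filter.Tendsto (fun x : ℝ => 1 / (x ^ 2 + 1)) (Filter.cocompact ℝ)
    (nhds 0) := by
  have h : Filter.Tendsto (fun x : ℝ => x ^ 2 + 1) (Filter.cocompact ℝ) Filter.atTop := by
    refine Filter.tendsto_atTop_add_const_right _ _ ?_
    have := (Filter.tendsto_pow_atTop (α := ℝ) two_ne_zero).comp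
      (tendsto_norm_cocompact_atTop (E := ℝ))
    simpa [Function.comp_def] using this
  simpa only [one_div] using! h.inv_tendsto_atTop

lemma tendsto_im_p : Filter.Tendsto (fun x : ℝ => x / (x ^ 2 + 1)) (Filter.cocompact ℝ)
    (nhds 0) := by
  have h : Filter.Tendsto (fun x : ℝ => ‖x‖⁻¹) (Filter.cocompact ℝ) (nhds 0) :=
    (tendsto_norm_cocompact_atTop (E := ℝ)).inv_tendsto_atTop
  refine squeeze_zero_norm (fun x => ?_) h
  rcases eq_or_ne x 0 with rfl | hx
  · simp
  have hx' : 0 < |x| := abs_pos.mpr hx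
  rw [norm_div, Real.norm_eq_abs, Real.norm_eq_abs, abs_of_pos (show 0 < x ^ 2 + 1 by positivity),
    div_le_iff₀ (by positivity), ← sq_abs x]
  field_simp
  linarith

lemma exists_tendsto {f : ℝ → ℝ} (hf : f ∈ ratAlg) :
    ∃ c, Filter.Tendsto f (Filter.cocompact ℝ) (nhds c) := by
  refine ratAlg_induction
    (P := fun f => ∃ c, Filter.Tendsto f (Filter.cocompact ℝ) (nhds c)) hf ⟨_, tendsto_re_p⟩ ⟨_, tendsto_im_p⟩ (fun c => ⟨c, tendsto_const_nhds⟩)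
    ?_ ?_
  · rintro f g - - ⟨C, hf⟩ ⟨D, hg⟩
    exact ⟨_, hf.add hg⟩
  · rintro f g - - ⟨C, hf⟩ ⟨D, hg⟩
    exact ⟨_, hf.mul hg⟩

lemma re_im_aeval_mem (E : ℝ[X]) : (fun θ => (aeval (p θ) E).re) ∈ ratAlg ∧
    (fun θ => (aeval (p θ) E).im) ∈ ratAlg := by
  induction E using Polynomial.induction_on with
  | C a => simpa using And.intro (const_mem a) (const_mem 0)
  | add f g hf hg =>
    simp only [map_add, Complex.add_re, Complex.add_im]
    exact ⟨ratAlg.add_mem hf.1 hg.1, ratAlg.add_mem hf.2 hg.2⟩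
  | monomial n a h =>
    simp only [pow_succ, ← mul_assoc]
    simp only [map_mul _ (C a * X ^ n) X, aeval_X, Complex.mul_re, Complex.mul_im, p_re, p_im]
    have hv := ratAlg.neg_mem im_p_mem
    exact ⟨ratAlg.sub_mem (ratAlg.mul_mem h.1 re_p_mem) (ratAlg.mul_mem h.2 hv),
      ratAlg.add_mem (ratAlg.mul_mem h.1 hv) (ratAlg.mul_mem h.2 re_p_mem)⟩

lemma L_mem (s : ℕ) : L (s + 1) ∈ ratAlg := by
  obtain ⟨E, hE⟩ := exists_isPrimitive s
  rw [funext (L_eq hE)]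
  exact (re_im_aeval_mem E).2

lemma im_aeval_ofReal (x : ℝ) (E : ℝ[X]) : (aeval (x : ℂ) E).im = 0 := by
  have := aeval_algebraMap_apply ℂ x E
  rw [Complex.coe_algebraMap] at this
  rw [this, Complex.ofReal_im]

/-- At θ = 0 the point p = 1 is real, and E has real coefficients. -/
lemma L_zero_right (s : ℕ) : L (s + 1) 0 = 0 := by
  obtain ⟨E, hE⟩ := exists_isPrimitive s
  rw [L_eq hE]
  have : p 0 = (1 : ℝ) := by simp [p]
  rw [this, im_aeval_ofReal]

/-- As |θ| → ∞, p tends to 0, so E(p) tends to the real number E(0), which need not vanish. -/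
lemma tendsto_L (s : ℕ) : Filter.Tendsto (L (s + 1)) (Filter.cocompact ℝ) (nhds 0) := by
  obtain ⟨E, hE⟩ := exists_isPrimitive s
  rw [funext (L_eq hE)]
  have hp : Filter.Tendsto p (Filter.cocompact ℝ) (nhds ((0 : ℝ) : ℂ)) := by
    have h1 := (Complex.continuous_ofReal.tendsto 0).comp tendsto_re_p
    have h2 := ((Complex.continuous_ofReal.tendsto _).comp tendsto_im_p.neg).mul_const Complex.I
    have h3 := h1.add h2
    refine (h3.congr fun x => ?_).trans (by simp)
    simp only [Function.comp]
    rw [← p_re, ← p_im, Complex.re_add_im]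
  have := (Complex.continuous_im.tendsto _).comp
    (((E.continuous_aeval (A := ℂ)).tendsto _).comp hp)
  rwa [im_aeval_ofReal] at this

/-! ### Closed forms of L_1, …, L_4. -/

lemma p_eq (θ : ℝ) : p θ = ((1 / (θ ^ 2 + 1) : ℝ) : ℂ) * (1 - θ * Complex.I) := by
  apply Complex.ext
  · rw [Complex.re_ofReal_mul, p_re]; simp
  · rw [Complex.im_ofReal_mul, p_im]; simp; ring

lemma im_p_pow (θ : ℝ) (n : ℕ) :
    (p θ ^ n).im = (1 / (θ ^ 2 + 1)) ^ n * ((1 - θ * Complex.I) ^ n).im := by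
  rw [p_eq, mul_pow, ← Complex.ofReal_pow, Complex.im_ofReal_mul]

lemma re_pow_succ (θ : ℝ) (n : ℕ) : ((1 - θ * Complex.I) ^ (n + 1)).re =
    ((1 - θ * Complex.I) ^ n).re + θ * ((1 - θ * Complex.I) ^ n).im := by
  rw [pow_succ, Complex.mul_re]; simp; ring

lemma im_pow_succ (θ : ℝ) (n : ℕ) : ((1 - θ * Complex.I) ^ (n + 1)).im =
    ((1 - θ * Complex.I) ^ n).im - θ * ((1 - θ * Complex.I) ^ n).re := by
  rw [pow_succ, Complex.mul_im]; simp; ring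

lemma riccati_one : riccati 1 = -2 * X ^ 3 + 3 * X ^ 2 - X := by
  rw [riccati_succ, Finset.sum_range_one, riccati_zero]
  simp
  ring

lemma riccati_two : riccati 2 = 10 * X ^ 5 - 22 * X ^ 4 + 15 * X ^ 3 - 3 * X ^ 2 := by
  rw [riccati_succ, Finset.sum_range_succ, Finset.sum_range_one, riccati_zero, riccati_one]
  simp
  simp only [C_ofNat]
  ring

lemma riccati_three : riccati 3 = -74 * X ^ 7 + 214 * X ^ 6 - 220 * X ^ 5 + 93 * X ^ 4
    - 13 * X ^ 3 := by
  rw [riccati_succ, Finset.sum_range_succ, Finset.sum_range_succ, Finset.sum_range_one,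
    riccati_zero, riccati_one, riccati_two]
  simp
  simp only [C_ofNat]
  ring

lemma riccati_four : riccati 4 = 706 * X ^ 9 - 2526 * X ^ 8 + 3464 * X ^ 7 - 2244 * X ^ 6
    + 671 * X ^ 5 - 71 * X ^ 4 := by
  rw [riccati_succ, Finset.sum_range_succ, Finset.sum_range_succ, Finset.sum_range_succ,
    Finset.sum_range_one, riccati_zero, riccati_one, riccati_two, riccati_three]
  simp
  simp only [C_ofNat]
  ring

lemma L_one (x : ℝ) : L 1 x = x * (1 - x ^ 2) / (x ^ 2 + 1) ^ 2 := by
  have h : IsPrimitive 1 (X - X ^ 2) := ⟨by rw [riccati_one]; simp; ring, by simp⟩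
  rw [L_eq h]
  simp only [map_sub, map_pow, aeval_X, Complex.sub_im, p_im, im_p_pow]
  simp only [im_pow_succ, re_pow_succ, pow_zero, Complex.one_re, Complex.one_im]
  field_simp
  ring

lemma L_two (x : ℝ) : L 2 x = -(x * (7 * x ^ 4 - 12 * x ^ 2 + 1)) / (x ^ 2 + 1) ^ 4 := by
  have h : IsPrimitive 2 (C (3 / 2) * X ^ 2 - C 4 * X ^ 3 + C (5 / 2) * X ^ 4) := by
    refine ⟨?_, by simp; norm_num⟩
    rw [riccati_two]
    simp only [derivative_add, derivative_sub, derivative_C_mul_X_pow]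
    norm_num
    simp only [C_ofNat]
    ring
  rw [L_eq h]
  simp only [map_sub, map_add, map_mul, map_pow, aeval_X, aeval_C, Complex.coe_algebraMap,
    Complex.sub_im, Complex.add_im, Complex.im_ofReal_mul, im_p_pow]
  simp only [im_pow_succ, re_pow_succ, pow_zero, Complex.one_re, Complex.one_im]
  field_simp
  ring

lemma L_three (x : ℝ) : L 3 x = x * (13 * x ^ 8 - 324 * x ^ 6 + 660 * x ^ 4 - 184 * x ^ 2 + 3)
    / (3 * (x ^ 2 + 1) ^ 6) := by
  have h : IsPrimitive 3 (C (13 / 3) * X ^ 3 - C 20 * X ^ 4 + C 28 * X ^ 5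
      - C (37 / 3) * X ^ 6) := by
    refine ⟨?_, by simp; norm_num⟩
    rw [riccati_three]
    simp only [derivative_add, derivative_sub, derivative_C_mul_X_pow]
    norm_num
    simp only [C_ofNat]
    ring
  rw [L_eq h]
  simp only [map_sub, map_add, map_mul, map_pow, aeval_X, aeval_C, Complex.coe_algebraMap,
    Complex.sub_im, Complex.add_im, Complex.im_ofReal_mul, im_p_pow]
  simp only [im_pow_succ, re_pow_succ, pow_zero, Complex.one_re, Complex.one_im]
  field_simp
  ring

lemma L_four (x : ℝ) : L 4 x = x * (191 * x ^ 10 - 2531 * x ^ 8 + 5600 * x ^ 6 - 2732 * x ^ 4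
    + 241 * x ^ 2 - 1) / (x ^ 2 + 1) ^ 8 := by
  have h : IsPrimitive 4 (C (71 / 4) * X ^ 4 - C 120 * X ^ 5 + C 274 * X ^ 6
      - C 260 * X ^ 7 + C (353 / 4) * X ^ 8) := by
    refine ⟨?_, by simp; norm_num⟩
    rw [riccati_four]
    simp only [derivative_add, derivative_sub, derivative_C_mul_X_pow]
    norm_num
    simp only [C_ofNat]
    ring
  rw [L_eq h]
  simp only [map_sub, map_add, map_mul, map_pow, aeval_X, aeval_C, Complex.coe_algebraMap,
    Complex.sub_im, Complex.add_im, Complex.im_ofReal_mul, im_p_pow]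
  simp only [im_pow_succ, re_pow_succ, pow_zero, Complex.one_re, Complex.one_im]
  field_simp
  ring

/-! ### The recursion for q_k; rationality and vanishing. -/

/-- The generating series of the coefficients `q_k (x)`. -/
noncomputable def qSeries (x : ℝ) : PowerSeries ℝ := PowerSeries.mk fun i => q i x

lemma q_zero (x : ℝ) : q 0 x = 0 := by rw [q]

lemma q_one (x : ℝ) : q 1 x = 0 := by rw [q]

lemma coeff_qSeries (m : ℕ) (x : ℝ) : PowerSeries.coeff m (qSeries x) = q m x :=
  PowerSeries.coeff_mk _ _

/-- As q_0 = q_1 = 0, the series is divisible by X². This is what makes all the differently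
truncated sums over j agree. -/
lemma coeff_qSeries_pow_eq_zero {m j : ℕ} (h : m < 2 * j) (x : ℝ) :
    PowerSeries.coeff m (qSeries x ^ j) = 0 := by
  have h1 : PowerSeries.X ^ 2 ∣ qSeries x := by
    rw [PowerSeries.X_pow_dvd_iff]
    intro i hi
    rw [coeff_qSeries]
    interval_cases i
    exacts [q_zero x, q_one x]
  have h2 := pow_dvd_pow_of_dvd h1 j
  rw [← pow_mul, PowerSeries.X_pow_dvd_iff] at h2
  exact h2 m h

/-- X^N divides f - g, and f - g divides f^j - g^j. -/
lemma coeff_pow_congr {R : Type*} [CommRing R] {N m : ℕ} (hm : m < N) {f g : PowerSeries R}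
    (h : ∀ i < N, PowerSeries.coeff i f = PowerSeries.coeff i g) (j : ℕ) :
    PowerSeries.coeff m (f ^ j) = PowerSeries.coeff m (g ^ j) := by
  have h1 : PowerSeries.X ^ N ∣ f - g := by
    rw [PowerSeries.X_pow_dvd_iff]
    intro i hi
    rw [map_sub, h i hi, sub_self]
  have h2 := h1.trans (sub_dvd_pow_sub_pow f g j)
  rw [PowerSeries.X_pow_dvd_iff] at h2
  have := h2 m hm
  rwa [map_sub, sub_eq_zero] at this

/-- The cutoff of the arguments at N, present for well-foundedness of the recursion, does not affect
coefficients below N. -/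
lemma bellB_args {N m : ℕ} (hm : m < N) (j : ℕ) (x : ℝ) :
    bellB m j (fun i => if i < N then (i.factorial : ℝ) * q i x else 0)
      = (m.factorial : ℝ) / j.factorial * PowerSeries.coeff m (qSeries x ^ j) := by
  rw [bellB]
  congr 1
  refine coeff_pow_congr hm (fun i hi => ?_) j
  rw [PowerSeries.coeff_mk, coeff_qSeries, if_pos hi]
  split_ifs with h0
  · rw [h0, q_zero]
  · field_simp

/-- The recursion of the `q_k` in a form which holds for all `k ≥ 2`. -/
lemma q_succ {k : ℕ} (hk : 0 < k) (x : ℝ) : q (k + 1) x =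
    ∑ j ∈ Finset.Icc 1 k, iteratedDeriv (j - 1) (fun y : ℝ => 1 / (y ^ 2 + 1)) x / j.factorial
        * PowerSeries.coeff k (qSeries x ^ j)
      - ∑ s ∈ Finset.Icc 1 k, ∑ j ∈ Finset.range (k + 1),
        iteratedDeriv j (L s) x / j.factorial * PowerSeries.coeff (k - s) (qSeries x ^ j) := by
  -- The summand s = k is the isolated term L_k of the definition: only j = 0 contributes.
  have hlast : ∑ j ∈ Finset.range (k + 1),
      iteratedDeriv j (L k) x / j.factorial * PowerSeries.coeff (k - k) (qSeries x ^ j) = L k x := by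
    rw [Finset.sum_range_succ', Finset.sum_eq_zero]
    · simp
    · intro j _
      rw [coeff_qSeries_pow_eq_zero (by omega), mul_zero]
  rcases k with _ | k
  · omega
  rw [Finset.sum_Icc_succ_top (by omega : 1 ≤ k + 1)
    (fun s => ∑ j ∈ Finset.range (k + 1 + 1), iteratedDeriv j (L s) x / j.factorial
        * PowerSeries.coeff (k + 1 - s) (qSeries x ^ j)), hlast]
  rcases k with _ | _ | k
  · simp [coeff_qSeries, q_one, L_one, q]
    ring
  · rw [q]
    simp [Finset.sum_Icc_succ_top, Finset.sum_range_succ, coeff_qSeries, q_one,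
      coeff_qSeries_pow_eq_zero]
    ring
  · rw [q]
    simp only [show k + 4 - 1 = k + 3 by omega, show k + 4 - 2 = k + 2 by omega,
      show k + 1 + 1 + 1 = k + 3 by omega, show k + 1 + 1 = k + 2 by omega]
    rw [← sub_sub]
    congr 2
    · rw [Finset.mul_sum]
      refine Finset.sum_congr rfl fun j _ => ?_
      rw [bellB_args (by omega)]
      field_simp
    · refine Finset.sum_congr rfl fun s hs => ?_
      rw [Finset.mem_Icc] at hs
      have hsub : Finset.Icc 1 (k + 3 - s) ⊆ Finset.range (k + 3 + 1) := by
        intro j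
        simp only [Finset.mem_Icc, Finset.mem_range]
        omega
      rw [show k + 4 - s - 1 = k + 3 - s by omega, ← Finset.sum_subset hsub]
      · refine Finset.sum_congr rfl fun j _ => ?_
        rw [bellB_args (by omega)]
        field_simp
      · intro j _ hj
        rw [Finset.mem_Icc, not_and_or] at hj
        rcases Nat.eq_zero_or_pos j with rfl | hj0
        · rw [pow_zero, PowerSeries.coeff_one, if_neg (by omega), mul_zero]
        · rw [coeff_qSeries_pow_eq_zero (by omega), mul_zero]

lemma coeff_pow_mem {A : ℕ → ℝ → ℝ} (N : ℕ) (hA : ∀ i < N, A i ∈ ratAlg) (j : ℕ) :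
    ∀ m < N, (fun x => PowerSeries.coeff m ((PowerSeries.mk fun i => A i x) ^ j)) ∈ ratAlg := by
  induction j with
  | zero =>
    intro m _
    simp only [pow_zero, PowerSeries.coeff_one]
    exact const_mem _
  | succ j ih =>
    intro m hm
    simp only [pow_succ, PowerSeries.coeff_mul, PowerSeries.coeff_mk]
    have : (fun x => ∑ y ∈ Finset.HasAntidiagonal.antidiagonal m, PowerSeries.coeff y.1
        ((PowerSeries.mk fun i => A i x) ^ j) * A y.2 x) = ∑ y ∈ Finset.HasAntidiagonal.antidiagonal m,
          (fun x => PowerSeries.coeff y.1 ((PowerSeries.mk fun i => A i x) ^ j)) * A y.2 := by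
      ext x
      simp
    rw [this]
    refine ratAlg.sum_mem fun y hy => ?_
    have := Finset.HasAntidiagonal.mem_antidiagonal.mp hy
    exact ratAlg.mul_mem (ih y.1 (by omega)) (hA y.2 (by omega))

lemma div_const_mem {f : ℝ → ℝ} (hf : f ∈ ratAlg) (c : ℝ) : (fun x => f x / c) ∈ ratAlg := by
  simp only [div_eq_mul_inv]
  exact ratAlg.mul_mem hf (const_mem _)

lemma sum_mem_ratAlg {ι : Type*} {t : Finset ι} {f : ι → ℝ → ℝ} (h : ∀ i ∈ t, f i ∈ ratAlg) :
    (fun x => ∑ i ∈ t, f i x) ∈ ratAlg := by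
  have := ratAlg.sum_mem h
  rwa [← funext fun x => Finset.sum_apply x t f]

lemma q_mem (k : ℕ) : q k ∈ ratAlg := by
  induction k using Nat.strong_induction_on with
  | _ k ih =>
    rcases k with _ | _ | k
    · rw [funext q_zero]; exact const_mem 0
    · rw [funext q_one]; exact const_mem 0
    · have hc : ∀ m < k + 2, ∀ j, (fun x => PowerSeries.coeff m (qSeries x ^ j)) ∈ ratAlg :=
        fun m hm j => coeff_pow_mem (k + 2) (fun i hi => ih i hi) j m hm
      rw [show q (k + 1 + 1) = _ from funext fun x => q_succ k.succ_pos x]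
      refine ratAlg.sub_mem (sum_mem_ratAlg fun j hj => ?_)
        (sum_mem_ratAlg fun s hs => sum_mem_ratAlg fun j hj => ?_)
      · exact ratAlg.mul_mem (div_const_mem (iteratedDeriv_mem re_p_mem _) _) (hc _ (by omega) j)
      · obtain ⟨s, rfl⟩ := Nat.exists_eq_succ_of_ne_zero
          (show s ≠ 0 by have := (Finset.mem_Icc.mp hs).1; omega)
        exact ratAlg.mul_mem (div_const_mem (iteratedDeriv_mem (L_mem s) _) _) (hc _ (by omega) j)

lemma tendsto_coeff_pow {l : Filter ℝ} (N : ℕ) (hq : ∀ i < N, Filter.Tendsto (q i) l (nhds 0))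
    (j : ℕ) : ∀ m < N, Filter.Tendsto (fun x => PowerSeries.coeff m (qSeries x ^ (j + 1))) l
      (nhds 0) := by
  have hqS : ∀ i < N, Filter.Tendsto (fun x => PowerSeries.coeff i (qSeries x)) l (nhds 0) :=
    fun i hi => (hq i hi).congr fun x => (coeff_qSeries i x).symm
  induction j with
  | zero => simpa using hqS
  | succ j ih =>
    intro m hm
    simp only [pow_succ _ (j + 1), PowerSeries.coeff_mul]
    rw [← Finset.sum_const_zero (s := Finset.HasAntidiagonal.antidiagonal m)]
    refine tendsto_finsetSum _ fun y hy => ?_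
    have := Finset.HasAntidiagonal.mem_antidiagonal.mp hy
    rw [← mul_zero (0 : ℝ)]
    exact (ih y.1 (by omega)).mul (hqS y.2 (by omega))

/-- The filter is left general so that one induction covers both infinity (`cocompact`) and the
point 0 (`pure 0`). In the recursion every term contains either a positive power of the q-series or
an undifferentiated L_s. -/
lemma tendsto_q {l : Filter ℝ} (hl : ∀ f ∈ ratAlg, ∃ c, Filter.Tendsto f l (nhds c))
    (hL : ∀ s, Filter.Tendsto (L (s + 1)) l (nhds 0)) (k : ℕ) :
    Filter.Tendsto (q k) l (nhds 0) := by
  induction k using Nat.strong_induction_on with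
  | _ k ih =>
    rcases k with _ | _ | k
    · rw [funext q_zero]; exact tendsto_const_nhds
    · rw [funext q_one]; exact tendsto_const_nhds
    · have hmul : ∀ f ∈ ratAlg, ∀ m < k + 2, ∀ j, Filter.Tendsto
          (fun x => f x * PowerSeries.coeff m (qSeries x ^ (j + 1))) l (nhds 0) := by
        intro f hf m hm j
        obtain ⟨c, hc⟩ := hl f hf
        rw [← mul_zero c]
        exact hc.mul (tendsto_coeff_pow _ ih j m hm)
      rw [show q (k + 1 + 1) = _ from funext fun x => q_succ k.succ_pos x, ← sub_zero (0 : ℝ)]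
      refine Filter.Tendsto.sub ?_ ?_
      · rw [← Finset.sum_const_zero (s := Finset.Icc 1 (k + 1))]
        refine tendsto_finsetSum _ fun j hj => ?_
        obtain ⟨j, rfl⟩ := Nat.exists_eq_succ_of_ne_zero
          (show j ≠ 0 by have := (Finset.mem_Icc.mp hj).1; omega)
        exact hmul _ (div_const_mem (iteratedDeriv_mem re_p_mem _) _) _ (by omega) _
      · rw [← Finset.sum_const_zero (s := Finset.Icc 1 (k + 1))]
        refine tendsto_finsetSum _ fun s hs => ?_
        obtain ⟨s, rfl⟩ := Nat.exists_eq_succ_of_ne_zero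
          (show s ≠ 0 by have := (Finset.mem_Icc.mp hs).1; omega)
        rw [← Finset.sum_const_zero (s := Finset.range (k + 1 + 1))]
        refine tendsto_finsetSum _ fun j hj => ?_
        rcases j with _ | j
        · simp only [pow_zero, iteratedDeriv_zero, Nat.factorial_zero, Nat.cast_one, div_one]
          rw [← zero_mul (PowerSeries.coeff (k + 1 - s.succ) (1 : PowerSeries ℝ))]
          exact (hL s).mul_const _
        · exact hmul _ (div_const_mem (iteratedDeriv_mem (L_mem s) _) _) _ (by omega) _

lemma tendsto_q_cocompact (k : ℕ) : Filter.Tendsto (q k) (Filter.cocompact ℝ) (nhds 0) :=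
  tendsto_q (fun _ hf => exists_tendsto hf) tendsto_L k

lemma q_zero_right (k : ℕ) : q k 0 = 0 := by
  have h := tendsto_q (l := pure 0) (fun f _ => ⟨f 0, tendsto_pure_nhds f 0⟩)
    (fun s => by simpa only [L_zero_right] using tendsto_pure_nhds (L (s + 1)) 0) k
  exact tendsto_nhds_unique (tendsto_pure_nhds (q k) 0) h

/-! ### Closed forms of q_2, …, q_5. -/

lemma q_two (x : ℝ) : q 2 x = x * (x ^ 2 - 1) / (x ^ 2 + 1) ^ 2 := by rw [q]

lemma q_three (x : ℝ) : q 3 x = 4 * x ^ 3 * (2 * x ^ 2 - 3) / (x ^ 2 + 1) ^ 4 := by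
  rw [q]
  beta_reduce
  rw [q_two, L_two]
  field_simp
  ring

lemma hasDerivAt_div_pow {f : ℝ → ℝ} {f' x : ℝ} (hf : HasDerivAt f f' x) (n : ℕ) :
    HasDerivAt (fun y => f y / (y ^ 2 + 1) ^ n)
      ((f' * (x ^ 2 + 1) - 2 * n * x * f x) / (x ^ 2 + 1) ^ (n + 1)) x := by
  have hx : x ^ 2 + 1 ≠ 0 := by positivity
  have h := hf.div (((hasDerivAt_pow 2 x).add_const 1).pow n) (pow_ne_zero n hx)
  refine h.congr_deriv ?_
  rcases n with _ | n
  · simp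
    field_simp
  · simp
    field_simp
    ring

lemma deriv_L_one (x : ℝ) : deriv (L 1) x = (x ^ 4 - 6 * x ^ 2 + 1) / (x ^ 2 + 1) ^ 3 := by
  have h : HasDerivAt (fun y : ℝ => y * (1 - y ^ 2)) (1 - 3 * x ^ 2) x := by
    refine ((hasDerivAt_id x).mul ((hasDerivAt_pow 2 x).const_sub 1)).congr_deriv ?_
    simp
    ring
  rw [funext L_one, (hasDerivAt_div_pow h 2).deriv]
  congr 1
  push_cast
  ring

lemma deriv_L_two (x : ℝ) :
    deriv (L 2) x = (21 * x ^ 6 - 95 * x ^ 4 + 43 * x ^ 2 - 1) / (x ^ 2 + 1) ^ 5 := by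
  have h : HasDerivAt (fun y : ℝ => -(y * (7 * y ^ 4 - 12 * y ^ 2 + 1)))
      (-(35 * x ^ 4 - 36 * x ^ 2 + 1)) x := by
    refine ((hasDerivAt_id x).mul ((((hasDerivAt_pow 4 x).const_mul 7).sub
      ((hasDerivAt_pow 2 x).const_mul 12)).add_const 1)).neg.congr_deriv ?_
    simp
    ring
  rw [funext L_two, (hasDerivAt_div_pow h 4).deriv]
  congr 1
  push_cast
  ring

lemma deriv_re_p (x : ℝ) :
    deriv (fun y : ℝ => 1 / (y ^ 2 + 1)) x = -(2 * x) / (x ^ 2 + 1) ^ 2 := by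
  have h := hasDerivAt_div_pow (hasDerivAt_const x (1 : ℝ)) 1
  simp only [pow_one] at h
  rw [h.deriv]
  congr 1
  push_cast
  ring

lemma q_four (x : ℝ) : q 4 x =
    -(2 * x ^ 3 * (8 * x ^ 6 - 183 * x ^ 4 + 336 * x ^ 2 - 65)) / (3 * (x ^ 2 + 1) ^ 6) := by
  rw [q_succ (by norm_num : 0 < 3)]
  simp [Finset.sum_Icc_succ_top, Finset.sum_range_succ, coeff_qSeries, q_one, q_zero,
    coeff_qSeries_pow_eq_zero, iteratedDeriv_one, PowerSeries.coeff_one]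
  rw [q_three, q_two, deriv_L_one, L_three]
  field_simp
  ring

lemma coeff_four_qSeries_sq (x : ℝ) : PowerSeries.coeff 4 (qSeries x ^ 2) = q 2 x ^ 2 := by
  rw [sq, PowerSeries.coeff_mul]
  simp [Finset.Nat.antidiagonal_succ, coeff_qSeries, q_one, q_zero]
  ring

lemma q_five (x : ℝ) : q 5 x =
    -(x ^ 3 * (679 * x ^ 8 - 8384 * x ^ 6 + 17226 * x ^ 4 - 7168 * x ^ 2 + 431)) /
      (3 * (x ^ 2 + 1) ^ 8) := by
  rw [q_succ (by norm_num : 0 < 4)]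
  simp [Finset.sum_Icc_succ_top, Finset.sum_range_succ, coeff_qSeries, q_one, q_zero,
    coeff_qSeries_pow_eq_zero, iteratedDeriv_one, PowerSeries.coeff_one, coeff_four_qSeries_sq,
    -one_div]
  rw [q_four, q_three, q_two, deriv_L_one, deriv_L_two, deriv_re_p, L_four]
  field_simp
  ring

/-! ### The truncated Riccati solution and its defect. -/

lemma norm_p_sq (θ : ℝ) : ‖p θ‖ ^ 2 = 1 / (θ ^ 2 + 1) := by
  rw [Complex.sq_norm, Complex.normSq_apply, p_re, p_im]
  field_simp
  ring

lemma norm_p_pos (θ : ℝ) : 0 < ‖p θ‖ :=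
  norm_pos_iff.mpr (inv_ne_zero (one_add_mul_I_ne_zero θ))

lemma norm_p_le_one (θ : ℝ) : ‖p θ‖ ≤ 1 := by
  rw [← abs_of_pos (norm_p_pos θ), ← sq_le_one_iff_abs_le_one, norm_p_sq,
    div_le_one (by positivity)]
  nlinarith [sq_nonneg θ]

lemma mul_norm_p_le_one {θ : ℝ} (hθ : 0 ≤ θ) : θ * ‖p θ‖ ≤ 1 := by
  rw [← abs_of_nonneg (mul_nonneg hθ (norm_p_pos θ).le), ← sq_le_one_iff_abs_le_one, mul_pow,
    norm_p_sq, mul_one_div, div_le_one (by positivity)]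
  linarith

lemma p_sub_one (θ : ℝ) : p θ - 1 = -(θ * Complex.I) * p θ := by
  linear_combination p_mul θ

lemma norm_p_sub_one (θ : ℝ) : ‖p θ - 1‖ = |θ| * ‖p θ‖ := by
  rw [p_sub_one]
  simp

lemma exists_norm_aeval_le (P : ℝ[X]) : ∃ C, 0 ≤ C ∧ ∀ θ, ‖aeval (p θ) P‖ ≤ C := by
  obtain ⟨C, hC, h1⟩ := exists_bound (re_im_aeval_mem P).1
  obtain ⟨D, hD, h2⟩ := exists_bound (re_im_aeval_mem P).2
  exact ⟨C + D, by positivity, fun θ =>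
    (Complex.norm_le_abs_re_add_abs_im _).trans (add_le_add (h1 θ) (h2 θ))⟩

lemma exists_norm_aeval_le_of_dvd {P : ℝ[X]} (h : X - 1 ∣ P) :
    ∃ C, 0 ≤ C ∧ ∀ θ, ‖aeval (p θ) P‖ ≤ C * (|θ| * ‖p θ‖) := by
  obtain ⟨Q, rfl⟩ := h
  obtain ⟨C, hC, h⟩ := exists_norm_aeval_le Q
  refine ⟨C, hC, fun θ => ?_⟩
  rw [map_mul, map_sub, aeval_X, map_one, norm_mul, norm_p_sub_one, mul_comm]
  exact mul_le_mul_of_nonneg_right (h θ) (by positivity)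

/-- Each factor of X contributes |p|, and X - 1 contributes |θ||p|; the cofactor is bounded. -/
lemma exists_norm_aeval_le_of_mul_dvd {P : ℝ[X]} (h : X * (X - 1) ∣ P) :
    ∃ C, 0 ≤ C ∧ ∀ θ, ‖aeval (p θ) P‖ ≤ C * (|θ| * ‖p θ‖ ^ 2) := by
  obtain ⟨Q, rfl⟩ := h
  obtain ⟨C, hC, h⟩ := exists_norm_aeval_le_of_dvd (P := (X - 1) * Q) (dvd_mul_right _ _)
  refine ⟨C, hC, fun θ => ?_⟩
  rw [mul_assoc, map_mul, aeval_X, norm_mul]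
  have := mul_le_mul_of_nonneg_left (h θ) (norm_nonneg (p θ))
  linarith

lemma hasDerivAt_p (θ : ℝ) : HasDerivAt p (-Complex.I * p θ ^ 2) θ := by
  have h0 : HasDerivAt (fun u : ℝ => 1 + (u : ℂ) * Complex.I) Complex.I θ := by
    have := ((hasDerivAt_id θ).ofReal_comp.mul_const Complex.I).const_add 1
    simpa using this
  refine (h0.inv (one_add_mul_I_ne_zero θ)).congr_deriv ?_
  rw [p, inv_pow]
  ring

lemma hasDerivAt_aeval_p (P : ℝ[X]) (θ : ℝ) : HasDerivAt (fun θ => aeval (p θ) P)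
    (aeval (p θ) (derivative P) * (-Complex.I * p θ ^ 2)) θ :=
  (P.hasDerivAt_aeval _).comp θ (hasDerivAt_p θ)

/-- Truncation of the expansion of the logarithmic derivative. -/
noncomputable def riccatiSum (N : ℕ) (a θ : ℝ) : ℂ :=
  ∑ s ∈ Finset.range (N + 1), aeval (p θ) (riccati s) / (a : ℂ) ^ s

/-- The derivative of `riccatiSum`. -/
noncomputable def riccatiSumDeriv (N : ℕ) (a θ : ℝ) : ℂ :=
  ∑ s ∈ Finset.range (N + 1),
    aeval (p θ) (derivative (riccati s)) * (-Complex.I * p θ ^ 2) / (a : ℂ) ^ s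

lemma hasDerivAt_riccatiSum (N : ℕ) (a θ : ℝ) :
    HasDerivAt (riccatiSum N a) (riccatiSumDeriv N a θ) θ :=
  HasDerivAt.fun_sum fun s _ => (hasDerivAt_aeval_p (riccati s) θ).div_const _

/-- The sum `∑ W i W j` over the square, split along the diagonal `i + j = N`. -/
lemma sum_mul_sum_split (W : ℕ → ℂ) (b : ℂ) (N : ℕ) :
    (∑ s ∈ Finset.range (N + 1), W s / b ^ s) ^ 2 =
      ∑ s ∈ Finset.range (N + 1), (∑ j ∈ Finset.range (s + 1), W j * W (s - j)) / b ^ s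
      + ∑ x ∈ (Finset.range (N + 1) ×ˢ Finset.range (N + 1)).filter (fun x => N < x.1 + x.2),
        W x.1 * W x.2 / b ^ (x.1 + x.2) := by
  rw [sq, Finset.sum_mul_sum, ← Finset.sum_product',
    ← Finset.sum_filter_not_add_sum_filter _ (fun x : ℕ × ℕ => N < x.1 + x.2)]
  congr 1
  · rw [← Finset.sum_fiberwise_of_maps_to (t := Finset.range (N + 1)) (g := fun x => x.1 + x.2)]
    · refine Finset.sum_congr rfl fun s hs => ?_
      rw [← Finset.Nat.sum_antidiagonal_eq_sum_range_succ (fun i j => W i * W j), Finset.sum_div]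
      refine Finset.sum_congr ?_ fun x hx => ?_
      · ext ⟨i, j⟩
        have := Finset.mem_range.mp hs
        simp only [Finset.mem_filter, Finset.mem_product, Finset.mem_range,
          Finset.HasAntidiagonal.mem_antidiagonal]
        omega
      · rw [← Finset.HasAntidiagonal.mem_antidiagonal.mp hx, pow_add]
        ring
    · intro x hx
      simp only [Finset.mem_filter, Finset.mem_product, Finset.mem_range] at hx ⊢
      omega
  · refine Finset.sum_congr rfl fun x _ => ?_
    rw [pow_add]
    ring

/-- The truncated series solves the Riccati equation up to a small remainder. -/
lemma exists_riccati_remainder_le {N : ℕ} (hN : 0 < N) :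
    ∃ C, 0 ≤ C ∧ ∀ a : ℝ, 1 ≤ a → ∀ θ : ℝ,
      ‖θ * riccatiSumDeriv N a θ + riccatiSum N a θ ^ 2
        + a * (1 + θ * Complex.I) * riccatiSum N a θ + a * (θ * Complex.I)‖
      ≤ C / a ^ N * (|θ| * ‖p θ‖ ^ 2) := by
  obtain ⟨C₀, hC₀, h₀⟩ := exists_norm_aeval_le_of_mul_dvd (X_mul_X_sub_one_dvd_riccati_step hN)
  set T := (Finset.range (N + 1) ×ˢ Finset.range (N + 1)).filter (fun x => N < x.1 + x.2) with hT
  have hex : ∀ x : ℕ × ℕ, ∃ C, 0 ≤ C ∧ (x ∈ T → ∀ θ,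
      ‖aeval (p θ) (riccati x.1 * riccati x.2)‖ ≤ C * (|θ| * ‖p θ‖ ^ 2)) := by
    intro x
    by_cases hx : x ∈ T
    · obtain ⟨C, hC, h⟩ := exists_norm_aeval_le_of_mul_dvd
        (X_mul_X_sub_one_dvd_riccati_mul (i := x.1) (j := x.2)
          (by have := (Finset.mem_filter.mp hx).2; omega))
      exact ⟨C, hC, fun _ => h⟩
    · exact ⟨0, le_rfl, fun h => absurd h hx⟩
  choose C hC hb using hex
  refine ⟨C₀ + ∑ x ∈ T, C x, add_nonneg hC₀ (Finset.sum_nonneg fun x _ => hC x),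
    fun a ha θ => ?_⟩
  have ha0 : (0 : ℝ) < a := by linarith
  have ha0' : (a : ℂ) ≠ 0 := by exact_mod_cast ha0.ne'
  set S : ℕ → ℝ[X] := fun s => X * (X - 1) * derivative (riccati s)
      + ∑ j ∈ Finset.range (s + 1), riccati j * riccati (s - j) with hS
  -- Multiplication by 1 + iθ cancels the factor p in the recursion; this is how each coefficient
  -- absorbs the defect of the previous order.
  have hW : ∀ s, (1 + θ * Complex.I) * aeval (p θ) (riccati (s + 1)) = -aeval (p θ) (S s) := by
    intro s
    rw [riccati_succ, map_neg, map_mul, aeval_X, mul_neg, ← mul_assoc, p_mul, one_mul]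
  have h1 : a * (1 + θ * Complex.I) * riccatiSum N a θ
      = -(a * (θ * Complex.I)) - ∑ s ∈ Finset.range N, aeval (p θ) (S s) / (a : ℂ) ^ s := by
    rw [riccatiSum, Finset.sum_range_succ', mul_add, Finset.mul_sum, riccati_zero, pow_zero,
      map_sub, aeval_X, map_one, div_one, add_comm,
      sub_eq_add_neg (-(a * (θ * Complex.I)) : ℂ), ← Finset.sum_neg_distrib]
    congr 1
    · linear_combination (a : ℂ) * p_mul θ
    · refine Finset.sum_congr rfl fun s _ => ?_
      rw [← neg_div, ← hW]
      field_simp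
      ring
  have h2 : θ * riccatiSumDeriv N a θ
      = ∑ s ∈ Finset.range (N + 1), aeval (p θ) (X * (X - 1) * derivative (riccati s))
        / (a : ℂ) ^ s := by
    rw [riccatiSumDeriv, Finset.mul_sum]
    refine Finset.sum_congr rfl fun s _ => ?_
    simp only [map_mul, map_sub, aeval_X, map_one, p_sub_one]
    ring
  have h3 := sum_mul_sum_split (fun s => aeval (p θ) (riccati s)) a N
  -- All orders below N cancel. What remains is the uncompensated term of order N and the products
  -- in V² of total order above N.
  have h4 : θ * riccatiSumDeriv N a θ + riccatiSum N a θ ^ 2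
        + a * (1 + θ * Complex.I) * riccatiSum N a θ + a * (θ * Complex.I)
      = aeval (p θ) (S N) / (a : ℂ) ^ N
        + ∑ x ∈ T, aeval (p θ) (riccati x.1 * riccati x.2) / (a : ℂ) ^ (x.1 + x.2) := by
    have h5 : ∑ s ∈ Finset.range (N + 1), aeval (p θ) (S s) / (a : ℂ) ^ s
        = ∑ s ∈ Finset.range (N + 1), aeval (p θ) (X * (X - 1) * derivative (riccati s))
          / (a : ℂ) ^ s + ∑ s ∈ Finset.range (N + 1), (∑ j ∈ Finset.range (s + 1),
            aeval (p θ) (riccati j) * aeval (p θ) (riccati (s - j))) / (a : ℂ) ^ s := by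
      rw [← Finset.sum_add_distrib]
      refine Finset.sum_congr rfl fun s _ => ?_
      simp only [hS, map_add, map_sum, map_mul, add_div]
    rw [Finset.sum_range_succ] at h5
    rw [h2, h1]
    simp only [map_mul _ (riccati _) (riccati _)]
    rw [riccatiSum, h3]
    linear_combination -h5
  rw [h4]
  have h5 : ∀ (z : ℂ) (c : ℝ) (m : ℕ), N ≤ m → 0 ≤ c → ‖z‖ ≤ c * (|θ| * ‖p θ‖ ^ 2) →
      ‖z / (a : ℂ) ^ m‖ ≤ c / a ^ N * (|θ| * ‖p θ‖ ^ 2) := by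
    intro z c m hm hc hz
    rw [norm_div, norm_pow, Complex.norm_real, Real.norm_of_nonneg ha0.le, div_mul_eq_mul_div]
    exact div_le_div₀ (by positivity) hz (by positivity) (pow_le_pow_right₀ ha hm)
  refine (norm_add_le _ _).trans ?_
  rw [add_div, add_mul]
  refine add_le_add (h5 _ _ _ le_rfl hC₀ (h₀ θ)) ((norm_sum_le _ _).trans ?_)
  rw [Finset.sum_div, Finset.sum_mul]
  refine Finset.sum_le_sum fun x hx => h5 _ _ _ (Finset.mem_filter.mp hx).2.le (hC x) (hb x hx θ)

lemma exists_riccatiSum_le (N : ℕ) : ∃ C, 0 ≤ C ∧ ∀ a : ℝ, 1 ≤ a → ∀ θ : ℝ,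
    ‖riccatiSum N a θ‖ ≤ C * (|θ| * ‖p θ‖) := by
  choose C hC h using fun s => exists_norm_aeval_le_of_dvd (X_sub_one_dvd_riccati s)
  refine ⟨∑ s ∈ Finset.range (N + 1), C s, Finset.sum_nonneg fun x _ => hC x, fun a ha θ => ?_⟩
  rw [riccatiSum, Finset.sum_mul]
  refine (norm_sum_le _ _).trans (Finset.sum_le_sum fun s _ => ?_)
  rw [norm_div, norm_pow, Complex.norm_real, Real.norm_of_nonneg (by linarith)]
  exact (div_le_self (norm_nonneg _) (one_le_pow₀ ha)).trans (h s θ)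

/-! ### Comparison of Ci + i Si with its approximation. -/

/-- `Ci(a, aθ) + i Si(a, aθ)`. -/
noncomputable def cis (a θ : ℝ) : ℂ := Ci a (a * θ) + Si a (a * θ) * Complex.I

/-- The factor `(aθ)ᵃ⁻¹ exp (iaθ)`. -/
noncomputable def expFactor (a θ : ℝ) : ℂ :=
  ((a * θ) ^ (a - 1) : ℝ) * Complex.exp ((a * θ : ℝ) * Complex.I)

lemma norm_expFactor {a θ : ℝ} (ha : 0 ≤ a) (hθ : 0 ≤ θ) :
    ‖expFactor a θ‖ = (a * θ) ^ (a - 1) := by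
  rw [expFactor, norm_mul, Complex.norm_exp_ofReal_mul_I, mul_one, Complex.norm_real,
    Real.norm_of_nonneg (Real.rpow_nonneg (by positivity) _)]

lemma hasDerivAt_cis {a : ℝ} (ha : 1 ≤ a) (θ : ℝ) :
    HasDerivAt (cis a) (a * expFactor a θ) θ := by
  have hlin : HasDerivAt (fun y : ℝ => a * y) a θ := by
    simpa using (hasDerivAt_id θ).const_mul a
  have hc : Continuous fun t : ℝ => t ^ (a - 1) := Real.continuous_rpow_const (by linarith)
  have h1 : HasDerivAt (fun y => Ci a (a * y)) ((a * θ) ^ (a - 1) * Real.cos (a * θ) * a) θ :=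
    ((hc.mul Real.continuous_cos).integral_hasStrictDerivAt 0 (a * θ)).hasDerivAt.comp θ hlin
  have h2 : HasDerivAt (fun y => Si a (a * y)) ((a * θ) ^ (a - 1) * Real.sin (a * θ) * a) θ :=
    ((hc.mul Real.continuous_sin).integral_hasStrictDerivAt 0 (a * θ)).hasDerivAt.comp θ hlin
  refine (h1.ofReal_comp.add (h2.ofReal_comp.mul_const Complex.I)).congr_deriv ?_
  rw [expFactor, Complex.exp_mul_I]
  push_cast
  ring

/-- The factor `(aθ)ᵃ exp (iaθ)`. -/
noncomputable def expFactor' (a θ : ℝ) : ℂ :=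
  ((a * θ) ^ a : ℝ) * Complex.exp ((a * θ : ℝ) * Complex.I)

lemma mul_rpow_sub_one {a x : ℝ} (ha : 1 < a) (hx : 0 ≤ x) : x * x ^ (a - 1) = x ^ a := by
  rcases hx.eq_or_lt with rfl | hx
  · rw [zero_mul, Real.zero_rpow (by linarith)]
  · rw [mul_comm, ← Real.rpow_add_one hx.ne', sub_add_cancel]

lemma expFactor'_eq {a θ : ℝ} (ha : 1 < a) (hθ : 0 ≤ θ) :
    expFactor' a θ = a * θ * expFactor a θ := by
  rw [expFactor', expFactor, ← mul_rpow_sub_one ha (by positivity)]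
  push_cast
  ring

lemma hasDerivAt_expFactor' {a θ : ℝ} (ha : 1 < a) (hθ : 0 ≤ θ) :
    HasDerivAt (expFactor' a) (a * expFactor a θ * (a * (1 + θ * Complex.I))) θ := by
  have hlin : HasDerivAt (fun y : ℝ => a * y) a θ := by
    simpa using (hasDerivAt_id θ).const_mul a
  have h1 := (hlin.rpow_const (p := a) (Or.inr ha.le)).ofReal_comp
  have h2 := (hlin.ofReal_comp.mul_const Complex.I).cexp
  refine (h1.mul h2).congr_deriv ?_
  rw [← mul_rpow_sub_one ha (show 0 ≤ a * θ by positivity), expFactor]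
  push_cast
  ring

lemma norm_mul_one_add_mul_I {a : ℝ} (ha : 0 ≤ a) (θ : ℝ) :
    ‖(a * (1 + θ * Complex.I) : ℂ)‖ = a / ‖p θ‖ := by
  rw [norm_mul, Complex.norm_real, Real.norm_of_nonneg ha, p, norm_inv, div_inv_eq_mul]

/-- The main term has modulus a/|p| ≥ a, while V is bounded uniformly in a and θ, so for large a at
most half is lost. -/
lemma exists_le_norm_add_riccatiSum (N : ℕ) : ∃ A : ℝ, ∀ a ≥ A, ∀ θ : ℝ, 0 ≤ θ →
    a / 2 / ‖p θ‖ ≤ ‖(a * (1 + θ * Complex.I) + riccatiSum N a θ : ℂ)‖ := by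
  obtain ⟨D, hD, hV⟩ := exists_riccatiSum_le N
  refine ⟨max 1 (2 * D), fun a ha θ hθ => ?_⟩
  have ha1 : 1 ≤ a := (le_max_left _ _).trans ha
  have haD : 2 * D ≤ a := (le_max_right _ _).trans ha
  have h2 : ‖riccatiSum N a θ‖ ≤ a / 2 / ‖p θ‖ := by
    refine (hV a ha1 θ).trans ?_
    rw [abs_of_nonneg hθ, le_div_iff₀ (norm_p_pos θ)]
    have h3 : D * (θ * ‖p θ‖) * ‖p θ‖ ≤ D * 1 * 1 :=
      mul_le_mul (mul_le_mul_of_nonneg_left (mul_norm_p_le_one hθ) hD) (norm_p_le_one θ)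
        (norm_nonneg _) (by positivity)
    linarith
  have h3 := norm_sub_le_norm_add (a * (1 + θ * Complex.I) : ℂ) (riccatiSum N a θ)
  rw [norm_mul_one_add_mul_I (by linarith)] at h3
  have h4 : a / ‖p θ‖ = a / 2 / ‖p θ‖ + a / 2 / ‖p θ‖ := by ring
  linarith

/-- Comparison of `cis a θ / expFactor' a θ` with its approximation. -/
lemma exists_cis_sub_le {N : ℕ} (hN : 0 < N) : ∃ C A : ℝ, 0 ≤ C ∧ 6 ≤ A ∧ ∀ a ≥ A, ∀ θ : ℝ,
    0 ≤ θ → ‖cis a θ - expFactor' a θ * (a * (1 + θ * Complex.I) + riccatiSum N a θ)⁻¹‖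
      ≤ C / a ^ (N + 3) * ((a * θ) ^ a * (θ / (θ ^ 2 + 1) ^ 2)) := by
  obtain ⟨C, hC, hB⟩ := exists_riccati_remainder_le hN
  obtain ⟨A, hA⟩ := exists_le_norm_add_riccatiSum N
  -- The squared inverse denominator gives a factor 4. Another 2 comes from bounding the barrier's
  -- growth factor a + 1 - 4θ²/(θ² + 1) ≥ a - 3 below by a/2, which needs a ≥ 6.
  refine ⟨8 * C, max 6 A, by positivity, le_max_left _ _, fun a ha θ₀ hθ₀ => ?_⟩
  have ha6 : 6 ≤ a := (le_max_left _ _).trans ha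
  have haD : A ≤ a := (le_max_right _ _).trans ha
  have ha0 : 0 < a := by linarith
  have hden := hA a haD
  have hden0 : ∀ θ : ℝ, 0 ≤ θ → (a * (1 + θ * Complex.I) + riccatiSum N a θ : ℂ) ≠ 0 := by
    intro θ hθ
    have := (hden θ hθ).trans_lt' (by have := norm_p_pos θ; positivity)
    exact norm_pos_iff.mp this
  set B : ℝ → ℂ := fun θ => θ * riccatiSumDeriv N a θ + riccatiSum N a θ ^ 2
        + a * (1 + θ * Complex.I) * riccatiSum N a θ + a * (θ * Complex.I) with hBdef
  -- The leading parts cancel: the derivative of the difference is proportional to the Riccati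
  -- defect `B`.
  have hf : ∀ θ : ℝ, 0 ≤ θ → HasDerivAt (fun θ => cis a θ -
      expFactor' a θ * (a * (1 + θ * Complex.I) + riccatiSum N a θ)⁻¹)
      (a * expFactor a θ * ((a * (1 + θ * Complex.I) + riccatiSum N a θ)⁻¹ ^ 2 * B θ)) θ := by
    intro θ hθ
    have h0 : HasDerivAt (fun u : ℝ => (a : ℂ) * (1 + (u : ℂ) * Complex.I)) (a * Complex.I) θ := by
      have := (((hasDerivAt_id θ).ofReal_comp.mul_const Complex.I).const_add 1).const_mul (a : ℂ)
      simpa using this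
    have h1 := (h0.add (hasDerivAt_riccatiSum N a θ)).inv (hden0 θ hθ)
    refine ((hasDerivAt_cis (by linarith) θ).sub
      ((hasDerivAt_expFactor' (by linarith) hθ).mul h1)).congr_deriv ?_
    have hne := hden0 θ hθ
    rw [expFactor'_eq (by linarith) hθ]
    simp only [hBdef, Pi.add_apply, Pi.inv_apply]
    field_simp
    ring
  have hM : ∀ θ : ℝ, 0 ≤ θ → HasDerivAt
      (fun θ => 8 * C / a ^ (N + 3) * ((a * θ) ^ a * (θ / (θ ^ 2 + 1) ^ 2)))
      (8 * C / a ^ (N + 3) * ((a * θ) ^ (a - 1) * (a * θ / (θ ^ 2 + 1) ^ 2 *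
        (a + 1 - 4 * θ ^ 2 / (θ ^ 2 + 1))))) θ := by
    intro θ hθ
    have hlin : HasDerivAt (fun y : ℝ => a * y) a θ := by
      simpa using (hasDerivAt_id θ).const_mul a
    have h1 := hlin.rpow_const (p := a) (Or.inr (by linarith))
    have h2 := (h1.mul (hasDerivAt_div_pow (hasDerivAt_id θ) 2)).const_mul (8 * C / a ^ (N + 3))
    refine h2.congr_deriv ?_
    rw [← mul_rpow_sub_one (show 1 < a by linarith) (show 0 ≤ a * θ by positivity)]
    simp only [id]
    field_simp
    push_cast
    ring
  have hbound : ∀ θ : ℝ, 0 ≤ θ →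
      ‖a * expFactor a θ * ((a * (1 + θ * Complex.I) + riccatiSum N a θ)⁻¹ ^ 2 * B θ)‖ ≤
      8 * C / a ^ (N + 3) * ((a * θ) ^ (a - 1) * (a * θ / (θ ^ 2 + 1) ^ 2 *
        (a + 1 - 4 * θ ^ 2 / (θ ^ 2 + 1)))) := by
    intro θ hθ
    have h1 : ‖(a * (1 + θ * Complex.I) + riccatiSum N a θ : ℂ)⁻¹‖ ≤ 2 / a * ‖p θ‖ := by
      rw [norm_inv]
      refine (inv_anti₀ (by have := norm_p_pos θ; positivity) (hden θ hθ)).trans ?_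
      rw [inv_div, div_div_eq_mul_div]
      apply le_of_eq
      ring
    have h2 : ‖B θ‖ ≤ C / a ^ N * (θ * ‖p θ‖ ^ 2) := by
      have := hB a (by linarith) θ
      rwa [abs_of_nonneg hθ] at this
    rw [norm_mul, norm_mul, norm_expFactor ha0.le hθ, Complex.norm_real,
      Real.norm_of_nonneg ha0.le, norm_mul, norm_pow]
    have h3 : 4 * θ ^ 2 / (θ ^ 2 + 1) ≤ 4 := by
      rw [div_le_iff₀ (by positivity)]; linarith
    have hr : 0 ≤ (a * θ) ^ (a - 1) := Real.rpow_nonneg (by positivity) _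
    calc a * (a * θ) ^ (a - 1) *
          (‖(a * (1 + θ * Complex.I) + riccatiSum N a θ : ℂ)⁻¹‖ ^ 2 * ‖B θ‖)
        ≤ a * (a * θ) ^ (a - 1) * ((2 / a * ‖p θ‖) ^ 2 * (C / a ^ N * (θ * ‖p θ‖ ^ 2))) := by
          gcongr
      _ = 8 * C / a ^ (N + 3) * ((a * θ) ^ (a - 1) * (a * θ / (θ ^ 2 + 1) ^ 2 * (a / 2))) := by
          have : (2 / a * ‖p θ‖) ^ 2 * (C / a ^ N * (θ * ‖p θ‖ ^ 2))
            = 4 / a ^ 2 * (C / a ^ N) * θ * (‖p θ‖ ^ 2) ^ 2 := by ring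
          rw [this, norm_p_sq]
          field_simp
          ring
      _ ≤ _ := by
          gcongr
          linarith
  -- The difference starts at 0, and its derivative is dominated by that of the barrier, so the
  -- barrier dominates it throughout.
  refine image_norm_le_of_norm_deriv_right_le_deriv_boundary' (a := 0) (b := θ₀)
    (fun θ hθ => (hf θ hθ.1).continuousAt.continuousWithinAt)
    (fun θ hθ => (hf θ hθ.1).hasDerivWithinAt) ?_
    (fun θ hθ => (hM θ hθ.1).continuousAt.continuousWithinAt)
    (fun θ hθ => (hM θ hθ.1).hasDerivWithinAt) (fun θ hθ => hbound θ hθ.1) ⟨hθ₀, le_rfl⟩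
  rw [expFactor'_eq (by linarith) le_rfl]
  simp [cis, Ci, Si]

/-- `cis a θ` divided by its leading approximation. -/
noncomputable def ratio (a θ : ℝ) : ℂ := a * (1 + θ * Complex.I) * cis a θ / expFactor' a θ

lemma norm_expFactor' {a θ : ℝ} (h : 0 ≤ a * θ) : ‖expFactor' a θ‖ = (a * θ) ^ a := by
  rw [expFactor', norm_mul, Complex.norm_exp_ofReal_mul_I, mul_one, Complex.norm_real,
    Real.norm_of_nonneg (Real.rpow_nonneg h _)]

/-- Closeness to 1 keeps `ratio` in the slit plane, where its argument is differentiable. The bound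
by C θ fixes the argument's limit at 0. The logarithmic derivative is exactly V/θ - (p - 1)/θ with V
the true Riccati solution, so only the error of the truncation has to be estimated. -/
lemma exists_ratio_estimate {N : ℕ} (hN : 0 < N) : ∃ C A : ℝ, 0 ≤ C ∧ 1 < A ∧ ∀ a ≥ A,
    ∀ θ : ℝ, 0 < θ → ‖ratio a θ - 1‖ ≤ 1 / 2 ∧ ‖ratio a θ - 1‖ ≤ C * θ ∧
      ∃ D, HasDerivAt (ratio a) D θ ∧
        ‖D / ratio a θ - (riccatiSum N a θ - (p θ - 1)) / θ‖ ≤ C / a ^ (N + 1) / (θ ^ 2 + 1) := by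
  obtain ⟨C, A₁, hC, hA₁, hcis⟩ := exists_cis_sub_le hN
  obtain ⟨A₂, hden⟩ := exists_le_norm_add_riccatiSum N
  obtain ⟨D, hD, hV⟩ := exists_riccatiSum_le N
  -- 4C arises from |Q| ≤ 2a/|p| and |ratio| ≥ 1/2, and 2D from the distance of r/Q to 1. The lower
  -- bound on a makes (C + 2D)/a at most 1/2.
  refine ⟨4 * C + 2 * D, max (max A₁ A₂) (8 * D + 4 * C), by positivity,
    lt_of_lt_of_le (by linarith) ((le_max_left _ _).trans (le_max_left _ _)), fun a ha θ hθ => ?_⟩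
  have haA₁ : A₁ ≤ a := ((le_max_left _ _).trans (le_max_left _ _)).trans ha
  have haA₂ : A₂ ≤ a := ((le_max_right _ _).trans (le_max_left _ _)).trans ha
  have haD : 8 * D + 4 * C ≤ a := (le_max_right _ _).trans ha
  have ha6 : 6 ≤ a := hA₁.trans haA₁
  have ha0 : 0 < a := by linarith
  have haC : (a : ℂ) ≠ 0 := by exact_mod_cast ha0.ne'
  have hθC : (θ : ℂ) ≠ 0 := by exact_mod_cast hθ.ne'
  have hp := norm_p_pos θ
  have hw := one_add_mul_I_ne_zero θ
  have haθ : 0 < a * θ := by positivity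
  have hE'norm := norm_expFactor' haθ.le
  have hE'pos : 0 < ‖expFactor' a θ‖ := by rw [hE'norm]; exact Real.rpow_pos_of_pos haθ _
  have hE' : expFactor' a θ ≠ 0 := norm_pos_iff.mp hE'pos
  have hE'eq := expFactor'_eq (show 1 < a by linarith) hθ.le
  have hE : expFactor a θ ≠ 0 := by
    intro h
    rw [h, mul_zero] at hE'eq
    exact hE' hE'eq
  set r : ℂ := a * (1 + θ * Complex.I) with hr
  have hr0 : r ≠ 0 := mul_ne_zero haC hw
  have hrnorm : ‖r‖ = a / ‖p θ‖ := norm_mul_one_add_mul_I ha0.le θ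
  set V := riccatiSum N a θ with hVdef
  set Q : ℂ := r + V with hQ
  have hQlow : a / 2 / ‖p θ‖ ≤ ‖Q‖ := hden a haA₂ θ hθ.le
  have hQ0 : Q ≠ 0 := norm_pos_iff.mp (hQlow.trans_lt' (by positivity))
  have hVle : ‖V‖ ≤ D * (θ * ‖p θ‖) := by
    have := hV a (by linarith) θ
    rwa [abs_of_pos hθ] at this
  have hθp : θ * ‖p θ‖ ≤ 1 := mul_norm_p_le_one hθ.le
  have hp1 := norm_p_le_one θ
  have hQup : ‖Q‖ ≤ 2 * a / ‖p θ‖ := by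
    refine (norm_add_le _ _).trans ?_
    rw [hrnorm]
    have h1 : D * (θ * ‖p θ‖) ≤ a / ‖p θ‖ := by
      rw [le_div_iff₀ hp]
      calc D * (θ * ‖p θ‖) * ‖p θ‖ ≤ D * 1 * 1 := by gcongr
        _ ≤ a := by linarith
    have h2 : 2 * a / ‖p θ‖ = a / ‖p θ‖ + a / ‖p θ‖ := by ring
    linarith
  have hdiff : ‖ratio a θ - r / Q‖ ≤ C / a ^ (N + 2) * (θ * ‖p θ‖ ^ 3) := by
    have h1 : ratio a θ - r / Q = r / expFactor' a θ * (cis a θ - expFactor' a θ * Q⁻¹) := by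
      rw [ratio, ← hr]
      field_simp
    rw [h1, norm_mul, norm_div, hrnorm, hE'norm]
    have hpos : 0 < (a * θ) ^ a := Real.rpow_pos_of_pos haθ _
    calc a / ‖p θ‖ / (a * θ) ^ a * ‖cis a θ - expFactor' a θ * Q⁻¹‖
        ≤ a / ‖p θ‖ / (a * θ) ^ a
          * (C / a ^ (N + 3) * ((a * θ) ^ a * (θ / (θ ^ 2 + 1) ^ 2))) := by
          gcongr
          exact hcis a haA₁ θ hθ.le
      _ = C / a ^ (N + 2) * (θ * ‖p θ‖ ^ 3) := by
          have h2 : θ / (θ ^ 2 + 1) ^ 2 = θ * (‖p θ‖ ^ 2) ^ 2 := by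
            rw [norm_p_sq]
            field_simp
          rw [h2]
          field_simp
          ring
  have hone : ‖r / Q - 1‖ ≤ 2 * D / a * (θ * ‖p θ‖ ^ 2) := by
    have h1 : r / Q - 1 = -V / Q := by
      rw [hQ] at hQ0 ⊢
      field_simp
      ring
    rw [h1, norm_div, norm_neg]
    calc ‖V‖ / ‖Q‖ ≤ D * (θ * ‖p θ‖) / (a / 2 / ‖p θ‖) := by gcongr
      _ = 2 * D / a * (θ * ‖p θ‖ ^ 2) := by field_simp
  have htot : ‖ratio a θ - 1‖ ≤ (C + 2 * D) / a * (θ * ‖p θ‖ ^ 2) := by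
    have h1 : ratio a θ - 1 = (ratio a θ - r / Q) + (r / Q - 1) := by ring
    rw [h1, add_div, add_mul]
    refine (norm_add_le _ _).trans (add_le_add (hdiff.trans ?_) hone)
    have h2 : a ≤ a ^ (N + 2) := le_self_pow₀ (by linarith) (by omega)
    have h3 : ‖p θ‖ ^ 3 ≤ ‖p θ‖ ^ 2 := pow_le_pow_of_le_one hp.le hp1 (by norm_num)
    gcongr
  have hhalf : ‖ratio a θ - 1‖ ≤ 1 / 2 := by
    refine htot.trans ?_
    have h1 : θ * ‖p θ‖ ^ 2 ≤ 1 := by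
      calc θ * ‖p θ‖ ^ 2 = θ * ‖p θ‖ * ‖p θ‖ := by ring
        _ ≤ 1 * 1 := by gcongr
        _ = 1 := one_mul 1
    have h2 : (C + 2 * D) / a ≤ 1 / 2 := by
      rw [div_le_iff₀ ha0]; linarith
    calc (C + 2 * D) / a * (θ * ‖p θ‖ ^ 2) ≤ 1 / 2 * 1 := by gcongr
      _ = 1 / 2 := mul_one _
  have hGlow : 1 / 2 ≤ ‖ratio a θ‖ := by
    have := norm_sub_norm_le (1 : ℂ) (1 - ratio a θ)
    rw [sub_sub_cancel, norm_one, norm_sub_rev] at this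
    linarith
  have hG0 : ratio a θ ≠ 0 := norm_pos_iff.mp (by linarith)
  have hc0 : cis a θ ≠ 0 := by
    intro h
    rw [ratio, h, mul_zero, zero_div] at hG0
    exact hG0 rfl
  refine ⟨hhalf, htot.trans ?_, ?_⟩
  · have h1 : (C + 2 * D) / a ≤ 4 * C + 2 * D := by
      rw [div_le_iff₀ ha0]
      have : (4 * C + 2 * D) * 1 ≤ (4 * C + 2 * D) * a :=
        mul_le_mul_of_nonneg_left (by linarith) (by positivity)
      linarith
    calc (C + 2 * D) / a * (θ * ‖p θ‖ ^ 2) ≤ (4 * C + 2 * D) * (θ * 1) := by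
          gcongr
          exact pow_le_one₀ hp.le hp1
      _ = _ := by rw [mul_one]
  · have h0 : HasDerivAt (fun u : ℝ => (a : ℂ) * (1 + (u : ℂ) * Complex.I)) (a * Complex.I) θ := by
      have := (((hasDerivAt_id θ).ofReal_comp.mul_const Complex.I).const_add 1).const_mul (a : ℂ)
      simpa using this
    have hder := (h0.mul (hasDerivAt_cis (show 1 ≤ a by linarith) θ)).div
      (hasDerivAt_expFactor' (show 1 < a by linarith) hθ.le) hE'
    refine ⟨_, hder, ?_⟩
    have h1 : ((a * Complex.I * cis a θ + r * (a * expFactor a θ)) * expFactor' a θ -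
        (r * cis a θ) * (a * expFactor a θ * r)) / expFactor' a θ ^ 2 / ratio a θ
        = Complex.I * p θ + (expFactor' a θ / cis a θ - r) / θ := by
      rw [ratio, p, hE'eq, hr]
      generalize (1 + (θ : ℂ) * Complex.I) = w at hw ⊢
      field_simp
      ring
    have h2 : ((a * Complex.I * cis a θ + r * (a * expFactor a θ)) * expFactor' a θ -
        (r * cis a θ) * (a * expFactor a θ * r)) / expFactor' a θ ^ 2 / ratio a θ
        - (V - (p θ - 1)) / θ = Q / θ * (r / Q - ratio a θ) / ratio a θ := by
      have h3 : Q / θ * (r / Q - ratio a θ) / ratio a θ = (expFactor' a θ / cis a θ - Q) / θ := by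
        rw [ratio, ← hr]
        field_simp
      rw [h1, h3, p_sub_one, hQ]
      field_simp
      ring
    refine (congrArg norm h2).trans_le ?_
    rw [norm_div, norm_mul, norm_div, Complex.norm_real, Real.norm_of_nonneg hθ.le, norm_sub_rev]
    calc ‖Q‖ / θ * ‖ratio a θ - r / Q‖ / ‖ratio a θ‖
        ≤ 2 * a / ‖p θ‖ / θ * (C / a ^ (N + 2) * (θ * ‖p θ‖ ^ 3)) / (1 / 2) := by gcongr
      _ = 4 * C / a ^ (N + 1) * ‖p θ‖ ^ 2 := by field_simp; ring
      _ = 4 * C / a ^ (N + 1) / (θ ^ 2 + 1) := by rw [norm_p_sq, mul_one_div]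
      _ ≤ _ := by
        gcongr
        linarith

/-! ### The phase and its uniform expansion. -/

/-- The deviation of the phase of `cis a θ` from `aθ - arctan θ`. -/
noncomputable def phaseShift (a θ : ℝ) : ℝ := (ratio a θ).arg

/-- Since θ d/dθ is p(p - 1) d/dp, the relation between E and its Riccati coefficient becomes a
derivative in θ. -/
lemma hasDerivAt_L (s : ℕ) {θ : ℝ} (hθ : 0 < θ) :
    HasDerivAt (L (s + 1)) (aeval (p θ) (riccati (s + 1)) / θ).im θ := by
  obtain ⟨E, hE⟩ := exists_isPrimitive s
  rw [funext (L_eq hE)]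
  have h := Complex.imCLM.hasFDerivAt.comp_hasDerivAt θ (hasDerivAt_aeval_p E θ)
  refine h.congr_deriv ?_
  have hθC : (θ : ℂ) ≠ 0 := by exact_mod_cast hθ.ne'
  rw [Complex.imCLM_apply, hE.1]
  congr 1
  simp only [map_mul, map_sub, aeval_X, map_one, p_sub_one]
  field_simp

lemma im_riccatiSum (N : ℕ) (a θ : ℝ) :
    ((riccatiSum N a θ - (p θ - 1)) / θ).im =
      ∑ s ∈ Finset.range N, (aeval (p θ) (riccati (s + 1)) / θ).im / a ^ (s + 1) := by
  rw [riccatiSum, Finset.sum_range_succ', riccati_zero, pow_zero, div_one, map_sub, aeval_X,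
    map_one, add_sub_cancel_right, Finset.sum_div, Complex.im_sum]
  refine Finset.sum_congr rfl fun s _ => ?_
  rw [div_right_comm, ← Complex.ofReal_pow, Complex.div_ofReal_im]

/-- A function which tends to `0` at `0` is controlled by a bound for its derivative. -/
lemma le_mul_arctan {F F' : ℝ → ℝ} {c : ℝ} (hF : ∀ θ > 0, HasDerivAt F (F' θ) θ)
    (hb : ∀ θ > 0, F' θ ≤ c / (θ ^ 2 + 1))
    (h0 : Filter.Tendsto F (nhdsWithin 0 (Set.Ioi 0)) (nhds 0)) {θ : ℝ} (hθ : 0 < θ) :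
    F θ ≤ c * Real.arctan θ := by
  have hd : ∀ x > 0, HasDerivAt (fun x => c * Real.arctan x - F x)
      (c * (1 / (1 + x ^ 2)) - F' x) x :=
    fun x hx => ((Real.hasDerivAt_arctan x).const_mul c).sub (hF x hx)
  have hmono : MonotoneOn (fun x => c * Real.arctan x - F x) (Set.Ioi 0) := by
    refine monotoneOn_of_deriv_nonneg (convex_Ioi 0)
      (fun x hx => (hd x hx).continuousAt.continuousWithinAt) (fun x hx => ?_) fun x hx => ?_
    · rw [interior_Ioi] at hx
      exact (hd x hx).differentiableAt.differentiableWithinAt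
    · rw [interior_Ioi] at hx
      rw [(hd x hx).deriv, mul_one_div, add_comm]
      exact sub_nonneg.mpr (hb x hx)
  have hlim : Filter.Tendsto (fun x => c * Real.arctan x - F x) (nhdsWithin 0 (Set.Ioi 0))
      (nhds 0) := by
    have h1 : Filter.Tendsto (fun x => c * Real.arctan x) (nhdsWithin 0 (Set.Ioi 0)) (nhds 0) := by
      have := ((Real.continuous_arctan.const_mul c).tendsto 0).mono_left
        (nhdsWithin_le_nhds (s := Set.Ioi 0))
      simpa using this
    simpa using h1.sub h0
  have := le_of_tendsto (b := c * Real.arctan θ - F θ) hlim ?_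
  · linarith
  · filter_upwards [Ioo_mem_nhdsGT hθ] with x hx
    exact hmono hx.1 hθ hx.2.le

lemma abs_le_mul_arctan {F F' : ℝ → ℝ} {c : ℝ} (hF : ∀ θ > 0, HasDerivAt F (F' θ) θ)
    (hb : ∀ θ > 0, |F' θ| ≤ c / (θ ^ 2 + 1))
    (h0 : Filter.Tendsto F (nhdsWithin 0 (Set.Ioi 0)) (nhds 0)) {θ : ℝ} (hθ : 0 < θ) :
    |F θ| ≤ c * Real.arctan θ := by
  rw [abs_le']
  refine ⟨le_mul_arctan hF (fun x hx => (le_abs_self _).trans (hb x hx)) h0 hθ, ?_⟩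
  exact le_mul_arctan (F := fun x => -F x) (F' := fun x => -F' x) (fun x hx => (hF x hx).neg)
    (fun x hx => (neg_le_abs _).trans (hb x hx)) (by simpa using h0.neg) hθ

/-- The argument is the imaginary part of the logarithm, so its derivative is the imaginary part of
the logarithmic derivative of `ratio`. -/
lemma exists_phaseShift_deriv {N : ℕ} (hN : 0 < N) : ∃ C A : ℝ, 0 ≤ C ∧ 1 < A ∧ ∀ a ≥ A,
    Filter.Tendsto (phaseShift a) (nhdsWithin 0 (Set.Ioi 0)) (nhds 0) ∧
    ∀ θ > 0, ratio a θ ≠ 0 ∧ ∃ d, HasDerivAt (phaseShift a) d θ ∧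
      |d - ∑ s ∈ Finset.range N, (aeval (p θ) (riccati (s + 1)) / θ).im / a ^ (s + 1)|
        ≤ C / a ^ (N + 1) / (θ ^ 2 + 1) := by
  obtain ⟨C, A, hC, hA, h⟩ := exists_ratio_estimate hN
  refine ⟨C, A, hC, hA, fun a ha => ⟨?_, fun θ hθ => ?_⟩⟩
  · have h1 : Filter.Tendsto (ratio a) (nhdsWithin 0 (Set.Ioi 0)) (nhds 1) := by
      rw [tendsto_iff_norm_sub_tendsto_zero]
      refine squeeze_zero' (g := fun θ => C * θ) (Filter.Eventually.of_forall fun _ =>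
        norm_nonneg _) ?_ ?_
      · filter_upwards [self_mem_nhdsWithin] with θ hθ
        exact (h a ha θ hθ).2.1
      · have := ((continuous_const_mul C).tendsto 0).mono_left
          (nhdsWithin_le_nhds (s := Set.Ioi 0))
        simpa using this
    have h2 := (Complex.continuousAt_arg Complex.one_mem_slitPlane).tendsto.comp h1
    rwa [Complex.arg_one] at h2
  · obtain ⟨h1, -, D, hD, hb⟩ := h a ha θ hθ
    have hs : ratio a θ ∈ Complex.slitPlane := by
      have := Complex.mem_slitPlane_of_norm_lt_one (z := ratio a θ - 1) (by linarith)
      rwa [add_sub_cancel] at this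
    refine ⟨Complex.slitPlane_ne_zero hs, (D / ratio a θ).im, ?_, ?_⟩
    · exact (Complex.imCLM.hasFDerivAt.comp_hasDerivAt θ (hD.clog_real hs)).congr_of_eventuallyEq
        (Filter.Eventually.of_forall fun x => (Complex.log_im (ratio a x)).symm)
    · rw [← im_riccatiSum, ← Complex.sub_im]
      exact (Complex.abs_im_le_norm _).trans hb

lemma tendsto_L_nhds_zero (s : ℕ) :
    Filter.Tendsto (L (s + 1)) (nhdsWithin 0 (Set.Ioi 0)) (nhds 0) := by
  obtain ⟨g, -, hg⟩ := exists_hasDerivAt (L_mem s)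
  have := (hg 0).continuousAt.tendsto.mono_left (nhdsWithin_le_nhds (s := Set.Ioi 0))
  rwa [L_zero_right] at this

/-- The uniform asymptotic expansion of the phase shift. -/
lemma exists_phaseShift_expansion {N : ℕ} (hN : 0 < N) : ∃ C A : ℝ, ∀ a ≥ A, ∀ θ > 0,
    |phaseShift a θ - ∑ s ∈ Finset.range N, L (s + 1) θ / a ^ (s + 1)| ≤ C / a ^ (N + 1) := by
  obtain ⟨C, A, hC, hA, h⟩ := exists_phaseShift_deriv hN
  -- The factor 2 bounds arctan θ < π/2, the total mass of 1/(1 + θ²) on (0, ∞).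
  refine ⟨C * 2, A, fun a ha θ hθ => ?_⟩
  have ha0 : 0 < a := by linarith
  choose d hd hb using fun x : Set.Ioi (0 : ℝ) => ((h a ha).2 x x.2).2
  set d' : ℝ → ℝ := fun x => if hx : 0 < x then d ⟨x, hx⟩ else 0 with hd'
  have key := abs_le_mul_arctan (c := C / a ^ (N + 1))
    (F := fun x => phaseShift a x - ∑ s ∈ Finset.range N, L (s + 1) x / a ^ (s + 1))
    (F' := fun x => d' x -
      ∑ s ∈ Finset.range N, (aeval (p x) (riccati (s + 1)) / x).im / a ^ (s + 1))
    (fun x hx => ?_) (fun x hx => ?_) ?_ hθ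
  · refine key.trans ?_
    rw [mul_div_right_comm]
    have := Real.arctan_lt_pi_div_two θ
    have := Real.pi_le_four
    gcongr
    linarith
  · simp only [hd', dif_pos hx.lt]
    exact (hd ⟨x, hx⟩).sub (HasDerivAt.fun_sum fun s _ => (hasDerivAt_L s hx).div_const _)
  · simp only [hd', dif_pos hx.lt]
    exact hb ⟨x, hx⟩
  · have h1 : Filter.Tendsto (fun x => ∑ s ∈ Finset.range N, L (s + 1) x / a ^ (s + 1))
        (nhdsWithin 0 (Set.Ioi 0)) (nhds 0) := by
      have := tendsto_finsetSum (Finset.range N) fun s _ =>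
        (tendsto_L_nhds_zero s).div_const (a ^ (s + 1))
      simpa using this
    simpa using (h a ha).1.sub h1

/-- The phase of `cis a θ`. -/
noncomputable def phase (a θ : ℝ) : ℝ := a * θ - Real.arctan θ + phaseShift a θ

lemma p_polar (θ : ℝ) : p θ = ‖p θ‖ * Complex.exp (-Real.arctan θ * Complex.I) := by
  have h1 : ‖p θ‖ = 1 / √(1 + θ ^ 2) := by
    rw [← Real.sqrt_sq (norm_nonneg (p θ)), norm_p_sq, Real.sqrt_div zero_le_one, Real.sqrt_one,
      add_comm]
  have h2 : √(1 + θ ^ 2) ^ 2 = 1 + θ ^ 2 := Real.sq_sqrt (by positivity)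
  have h3 : √(1 + θ ^ 2) ≠ 0 := by positivity
  rw [← Complex.ofReal_neg, Complex.exp_ofReal_mul_I]
  apply Complex.ext
  · rw [Complex.re_ofReal_mul, p_re, h1]
    simp [-Complex.ofReal_neg, -Complex.ofReal_cos, -Complex.ofReal_sin, Real.cos_arctan]
    rw [← mul_inv, ← sq, h2, add_comm]
  · rw [Complex.im_ofReal_mul, p_im, h1]
    simp [-Complex.ofReal_neg, -Complex.ofReal_cos, -Complex.ofReal_sin, Real.sin_arctan]
    rw [inv_mul_eq_div, div_div, ← sq, h2, add_comm]

/-- The three factors `ratio`, p and exp(iaθ) contribute the angles `phaseShift`, -arctan θ and aθ;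
everything else is positive. -/
lemma cis_polar {a θ : ℝ} (ha : 0 < a) (hθ : 0 < θ) (h : ratio a θ ≠ 0) :
    ∃ r : ℝ, 0 < r ∧ cis a θ = r * Complex.exp (phase a θ * Complex.I) := by
  refine ⟨‖ratio a θ‖ * ‖p θ‖ * (a * θ) ^ a / a, ?_, ?_⟩
  · have := norm_pos_iff.mpr h
    have := norm_p_pos θ
    have := Real.rpow_pos_of_pos (mul_pos ha hθ) a
    positivity
  · have haC : (a : ℂ) ≠ 0 := by exact_mod_cast ha.ne'
    have hE : expFactor' a θ ≠ 0 := by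
      rw [← norm_pos_iff, norm_expFactor' (by positivity)]
      exact Real.rpow_pos_of_pos (by positivity) _
    have h1 : cis a θ = ratio a θ * p θ * expFactor' a θ / a := by
      have := p_mul θ
      rw [ratio]
      field_simp
      linear_combination -cis a θ * this
    have h2 : Complex.exp (phase a θ * Complex.I) = Complex.exp ((a * θ : ℝ) * Complex.I)
        * Complex.exp (-Real.arctan θ * Complex.I)
        * Complex.exp ((ratio a θ).arg * Complex.I) := by
      rw [← Complex.exp_add, ← Complex.exp_add, phase, phaseShift]
      congr 1
      push_cast
      ring
    rw [h1, h2]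
    conv_lhs => rw [p_polar, ← Complex.norm_mul_exp_arg_mul_I (ratio a θ)]
    rw [expFactor']
    push_cast
    ring

lemma Ti_eq (a θ α : ℝ) :
    Ti a (a * θ) α = (cis a θ * Complex.exp (-(Real.pi * α : ℝ) * Complex.I)).re := by
  rw [← Complex.ofReal_neg, Complex.exp_ofReal_mul_I, Ti, cis, Real.cos_neg, Real.sin_neg,
    Complex.mul_re]
  simp [-Complex.ofReal_cos, -Complex.ofReal_sin]

lemma Ti_eq_zero_iff {a θ α : ℝ} (ha : 0 < a) (hθ : 0 < θ) (h : ratio a θ ≠ 0) :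
    Ti a (a * θ) α = 0 ↔ ∃ k : ℤ, phase a θ = (k + 1 / 2 + α) * Real.pi := by
  obtain ⟨r, hr, hc⟩ := cis_polar ha hθ h
  have h1 : cis a θ * Complex.exp (-(Real.pi * α : ℝ) * Complex.I)
      = r * Complex.exp ((phase a θ - Real.pi * α : ℝ) * Complex.I) := by
    rw [hc, mul_assoc, ← Complex.exp_add]
    congr 2
    push_cast
    ring
  rw [Ti_eq, h1, Complex.re_ofReal_mul, Complex.exp_ofReal_mul_I_re, mul_eq_zero,
    or_iff_right hr.ne', Real.cos_eq_zero_iff]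
  refine exists_congr fun k => ?_
  constructor <;> intro h <;> linarith

/-- Monotonicity and limiting behaviour of the phase. -/
lemma exists_phase_properties : ∃ A : ℝ, 1 < A ∧ ∀ a ≥ A,
    Filter.Tendsto (phase a) (nhdsWithin 0 (Set.Ioi 0)) (nhds 0) ∧
    ∀ θ > 0, ratio a θ ≠ 0 ∧ ∃ d, a / 2 ≤ d ∧ HasDerivAt (phase a) d θ := by
  obtain ⟨C, A, hC, hA, h⟩ := exists_phaseShift_deriv one_pos
  obtain ⟨g, hgm, hg⟩ := exists_hasDerivAt (L_mem 0)
  obtain ⟨B, hB, hgB⟩ := exists_bound hgm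
  refine ⟨max A (2 * (1 + C + B)), lt_of_lt_of_le hA (le_max_left _ _), fun a ha => ?_⟩
  have haA : A ≤ a := (le_max_left _ _).trans ha
  have haB : 2 * (1 + C + B) ≤ a := (le_max_right _ _).trans ha
  have ha0 : 0 < a := by linarith
  refine ⟨?_, fun θ hθ => ?_⟩
  · have h1 : Filter.Tendsto (fun θ => a * θ - Real.arctan θ) (nhdsWithin 0 (Set.Ioi 0))
        (nhds 0) := by
      have := (((continuous_const_mul a).sub Real.continuous_arctan).tendsto 0).mono_left
        (nhdsWithin_le_nhds (s := Set.Ioi 0))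
      simpa using! this
    have := h1.add (h a haA).1
    rwa [add_zero] at this
  · obtain ⟨hne, d, hd, hb⟩ := (h a haA).2 θ hθ
    refine ⟨hne, _, ?_, (((hasDerivAt_id θ).const_mul a).sub (Real.hasDerivAt_arctan θ)).add hd⟩
    rw [Finset.sum_range_one, (hg θ).unique (hasDerivAt_L 0 hθ) |>.symm] at hb
    have h1 : |g θ / a ^ (0 + 1)| ≤ B := by
      rw [abs_div, zero_add, pow_one, abs_of_pos ha0]
      exact (div_le_self (abs_nonneg _) (by linarith)).trans (hgB θ)
    have h2 : C / a ^ (1 + 1) / (θ ^ 2 + 1) ≤ C := by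
      rw [div_div]
      refine div_le_self hC ?_
      have : 1 ≤ a ^ (1 + 1) := one_le_pow₀ (by linarith)
      nlinarith [sq_nonneg θ]
    have h3 : 1 / (1 + θ ^ 2) ≤ 1 := by
      rw [div_le_one (by positivity)]; nlinarith [sq_nonneg θ]
    have h4 := (abs_le.mp h1).1
    have h5 := (abs_le.mp (hb.trans h2)).1
    simp only [mul_one]
    linarith

/-! ### Formal solution of the phase equation and its error. -/

lemma sum_Icc_one_eq_sum_range {M : Type*} [AddCommMonoid M] (f : ℕ → M) (n : ℕ) :
    ∑ j ∈ Finset.Icc 1 n, f j = ∑ j ∈ Finset.range n, f (j + 1) := by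
  induction n with
  | zero => simp
  | succ n ih => rw [Finset.sum_Icc_succ_top (by omega), Finset.sum_range_succ, ih]

/-- The truncated expansion of the displacement of a zero, as a polynomial in `1 / a`. -/
noncomputable def qPoly (n : ℕ) (x : ℝ) : ℝ[X] := ∑ k ∈ Finset.Icc 2 n, C (q k x) * X ^ k

lemma coeff_qPoly {n i : ℕ} (hi : i ≤ n) (x : ℝ) : (qPoly n x).coeff i = q i x := by
  simp only [qPoly, finsetSum_coeff, coeff_C_mul_X_pow, Finset.sum_ite_eq, Finset.mem_Icc]
  split_ifs with h
  · rfl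
  · have : i < 2 := by omega
    interval_cases i
    exacts [(q_zero x).symm, (q_one x).symm]

lemma coeff_qPoly_pow {n i : ℕ} (hi : i ≤ n) (x : ℝ) (j : ℕ) :
    (qPoly n x ^ j).coeff i = PowerSeries.coeff i (qSeries x ^ j) := by
  rw [← Polynomial.coeff_coe, Polynomial.coe_pow]
  refine coeff_pow_congr (Nat.lt_succ_of_le hi) (fun k hk => ?_) j
  rw [Polynomial.coeff_coe, coeff_qPoly (Nat.le_of_lt_succ hk), coeff_qSeries]

/-- The result of substituting `qPoly` into the Taylor polynomials in the phase equation. -/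
noncomputable def residual (n : ℕ) (x : ℝ) : ℝ[X] :=
  ∑ k ∈ Finset.Icc 2 n, C (q k x) * X ^ (k - 1)
    - ∑ j ∈ Finset.range n,
      C (iteratedDeriv j (fun y : ℝ => 1 / (y ^ 2 + 1)) x / ((j + 1).factorial : ℝ))
        * qPoly n x ^ (j + 1)
    + ∑ s ∈ Finset.range (n - 1), X ^ (s + 1) * ∑ j ∈ Finset.range (n + 1),
      C (iteratedDeriv j (L (s + 1)) x / j.factorial) * qPoly n x ^ j

/-- With t = 1/a, the coefficient of t^m is q_(m+1) minus the right-hand side of its recursion. The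
truncations in `residual` remove only terms that vanish or have order at least n. -/
lemma coeff_residual {n m : ℕ} (hm : m < n) (x : ℝ) : (residual n x).coeff m = 0 := by
  have h1 : (∑ k ∈ Finset.Icc 2 n, C (q k x) * X ^ (k - 1)).coeff m = q (m + 1) x := by
    simp only [finsetSum_coeff, coeff_C_mul_X_pow]
    rcases m with _ | m
    · rw [zero_add, q_one]
      refine Finset.sum_eq_zero fun k hk => if_neg ?_
      have := Finset.mem_Icc.mp hk
      omega
    · rw [Finset.sum_eq_single_of_mem (m + 1 + 1) (Finset.mem_Icc.mpr (by omega)), if_pos (by omega)]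
      intro k hk hne
      have := Finset.mem_Icc.mp hk
      exact if_neg (by omega)
  rw [residual, coeff_add, coeff_sub, h1]
  simp only [finsetSum_coeff, coeff_C_mul, coeff_X_pow_mul']
  have h2 : ∀ i ≤ m, ∀ j, (qPoly n x ^ j).coeff i = PowerSeries.coeff i (qSeries x ^ j) :=
    fun i hi j => coeff_qPoly_pow (by omega) x j
  rcases Nat.eq_zero_or_pos m with rfl | hm0
  · rw [zero_add, q_one]
    rw [Finset.sum_eq_zero, Finset.sum_eq_zero]
    · ring
    · exact fun s _ => if_neg (by omega)
    · intro j _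
      rw [h2 0 le_rfl, coeff_qSeries_pow_eq_zero (by omega), mul_zero]
  · rw [q_succ hm0, sum_Icc_one_eq_sum_range, sum_Icc_one_eq_sum_range]
    have h3 : ∑ j ∈ Finset.range n, iteratedDeriv j (fun y : ℝ => 1 / (y ^ 2 + 1)) x
          / (j + 1).factorial * (qPoly n x ^ (j + 1)).coeff m
        = ∑ j ∈ Finset.range m, iteratedDeriv (j + 1 - 1) (fun y : ℝ => 1 / (y ^ 2 + 1)) x
          / (j + 1).factorial * PowerSeries.coeff m (qSeries x ^ (j + 1)) := by
      rw [← Finset.sum_subset (Finset.range_subset_range.mpr hm.le)]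
      · exact Finset.sum_congr rfl fun j _ => by rw [h2 m le_rfl, Nat.add_sub_cancel]
      · intro j _ hj
        rw [Finset.mem_range] at hj
        rw [h2 m le_rfl, coeff_qSeries_pow_eq_zero (by omega), mul_zero]
    have h4 : (∑ s ∈ Finset.range (n - 1), if s + 1 ≤ m then (∑ j ∈ Finset.range (n + 1),
          C (iteratedDeriv j (L (s + 1)) x / j.factorial) * qPoly n x ^ j).coeff (m - (s + 1))
          else 0)
        = ∑ s ∈ Finset.range m, ∑ j ∈ Finset.range (m + 1),
          iteratedDeriv j (L (s + 1)) x / j.factorial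
            * PowerSeries.coeff (m - (s + 1)) (qSeries x ^ j) := by
      rw [← Finset.sum_subset (Finset.range_subset_range.mpr (show m ≤ n - 1 by omega))]
      · refine Finset.sum_congr rfl fun s hs => ?_
        have hs' := Finset.mem_range.mp hs
        rw [if_pos (by omega), finsetSum_coeff,
          ← Finset.sum_subset (Finset.range_subset_range.mpr (show m + 1 ≤ n + 1 by omega))]
        · exact Finset.sum_congr rfl fun j _ => by rw [coeff_C_mul, h2 _ (by omega)]
        · intro j _ hj
          rw [Finset.mem_range] at hj
          rw [coeff_C_mul, h2 _ (by omega), coeff_qSeries_pow_eq_zero (by omega), mul_zero]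
      · intro s _ hs
        rw [Finset.mem_range] at hs
        exact if_neg (by omega)
    simp only [finsetSum_coeff, coeff_C_mul] at h4
    rw [h3, h4]
    ring

/-- Evaluation at a point, on `ratAlg`. -/
noncomputable def evalAt (x : ℝ) : ratAlg →+* ℝ :=
  (Pi.evalRingHom (fun _ : ℝ => ℝ) x).comp ratAlg.val.toRingHom

/-- Regarding the residual as one polynomial over the algebra bounds its degree and its coefficients
independently of x. -/
lemma exists_residual_lift (n : ℕ) :
    ∃ P : (ratAlg : Subalgebra ℝ (ℝ → ℝ))[X], ∀ x, P.map (evalAt x) = residual n x := by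
  let c : ∀ f : ℝ → ℝ, f ∈ ratAlg → ratAlg := fun f hf => ⟨f, hf⟩
  have hc : ∀ f hf x, evalAt x (c f hf) = f x := fun _ _ _ => rfl
  let qP : ratAlg[X] := ∑ k ∈ Finset.Icc 2 n, C (c (q k) (q_mem k)) * X ^ k
  refine ⟨∑ k ∈ Finset.Icc 2 n, C (c (q k) (q_mem k)) * X ^ (k - 1)
    - ∑ j ∈ Finset.range n, C (c _ (div_const_mem (iteratedDeriv_mem re_p_mem j)
      (j + 1).factorial)) * qP ^ (j + 1)
    + ∑ s ∈ Finset.range (n - 1), X ^ (s + 1) * ∑ j ∈ Finset.range (n + 1),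
      C (c _ (div_const_mem (iteratedDeriv_mem (L_mem s) j) j.factorial)) * qP ^ j, fun x => ?_⟩
  simp [residual, qPoly, qP, Polynomial.map_sum, hc]

lemma exists_eval_residual_le (n : ℕ) : ∃ K, 0 ≤ K ∧ ∀ x t : ℝ, 0 ≤ t → t ≤ 1 →
    |(residual n x).eval t| ≤ K * t ^ n := by
  obtain ⟨P, hP⟩ := exists_residual_lift n
  choose K hK0 hK using fun i : ℕ => exists_bound (P.coeff i).2
  refine ⟨∑ i ∈ Finset.range (P.natDegree + 1), K i, Finset.sum_nonneg fun i _ => hK0 i,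
    fun x t ht0 ht1 => ?_⟩
  have hdeg : (residual n x).natDegree < P.natDegree + 1 := by
    rw [← hP]
    exact Nat.lt_succ_of_le natDegree_map_le
  rw [eval_eq_sum_range' hdeg, Finset.sum_mul]
  refine (Finset.abs_sum_le_sum_abs _ _).trans (Finset.sum_le_sum fun i _ => ?_)
  rcases lt_or_ge i n with hi | hi
  · rw [coeff_residual hi, zero_mul, abs_zero]
    exact mul_nonneg (hK0 i) (pow_nonneg ht0 n)
  · rw [abs_mul, abs_of_nonneg (pow_nonneg ht0 i), ← hP, coeff_map]
    exact mul_le_mul (hK i x) (pow_le_pow_of_le_one ht0 ht1 hi) (pow_nonneg ht0 i) (hK0 i)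

/-- Taylor's formula with a bound that is uniform in the base point. -/
lemma abs_sub_taylor_le {f : ℕ → ℝ → ℝ} (hf : ∀ n x, HasDerivAt (f n) (f (n + 1) x) x) {n : ℕ}
    {B : ℝ} (hB : ∀ x, |f n x| ≤ B) (x h : ℝ) :
    |f 0 (x + h) - ∑ j ∈ Finset.range n, f j x / j.factorial * h ^ j| ≤ B * |h| ^ n := by
  induction n generalizing f h with
  | zero => simpa using hB (x + h)
  | succ n ih =>
    -- The derivative in y of the remainder of f is the remainder of f' with one term less; the mean
    -- value inequality then supplies the extra power of |h|.
    have hB0 : 0 ≤ B := (abs_nonneg _).trans (hB 0)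
    have hR : ∀ y, HasDerivAt
        (fun y => f 0 (x + y) - ∑ j ∈ Finset.range (n + 1), f j x / j.factorial * y ^ j)
        (f 1 (x + y) - ∑ j ∈ Finset.range n, f (j + 1) x / j.factorial * y ^ j) y := by
      intro y
      have h1 : HasDerivAt (fun y => f 0 (x + y)) (f 1 (x + y)) y := by
        simpa using (hf 0 (x + y)).comp_const_add x y
      have h2 : HasDerivAt (fun y => ∑ j ∈ Finset.range (n + 1), f j x / j.factorial * y ^ j)
          (∑ j ∈ Finset.range n, f (j + 1) x / j.factorial * y ^ j) y := by
        have h3 := HasDerivAt.fun_sum (u := Finset.range (n + 1)) (x := y) fun j _ =>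
          (hasDerivAt_pow j y).const_mul (f j x / j.factorial)
        refine h3.congr_deriv ?_
        rw [Finset.sum_range_succ']
        simp only [Nat.cast_zero, zero_mul, mul_zero, add_zero, Nat.add_sub_cancel]
        refine Finset.sum_congr rfl fun j _ => ?_
        rw [Nat.factorial_succ]
        push_cast
        field_simp
      exact h1.sub h2
    have hR' : ∀ y ∈ Set.Icc (-|h|) |h|,
        ‖f 1 (x + y) - ∑ j ∈ Finset.range n, f (j + 1) x / j.factorial * y ^ j‖
          ≤ B * |h| ^ n := by
      intro y hy
      refine (ih (f := fun j => f (j + 1)) (fun m => hf (m + 1)) hB y).trans ?_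
      exact mul_le_mul_of_nonneg_left (pow_le_pow_left₀ (abs_nonneg _) (abs_le.mpr hy) n) hB0
    have := (convex_Icc (-|h|) |h|).norm_image_sub_le_of_norm_hasDerivWithin_le
      (fun y _ => (hR y).hasDerivWithinAt) hR' (x := 0) (y := h) (by simp)
      ⟨neg_abs_le h, le_abs_self h⟩
    simp only [Finset.sum_range_succ' _ n] at this
    simp only [add_zero, sub_zero, Real.norm_eq_abs] at this
    rw [Finset.sum_range_succ' _ n]
    simpa [pow_succ, mul_assoc] using this

lemma exists_eval_qPoly_le (n : ℕ) : ∃ B, 0 ≤ B ∧ ∀ x t : ℝ, 0 ≤ t → t ≤ 1 →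
    |(qPoly n x).eval t| ≤ B * t := by
  choose B hB0 hB using fun k => exists_bound (q_mem k)
  refine ⟨∑ k ∈ Finset.Icc 2 n, B k, Finset.sum_nonneg fun k _ => hB0 k, fun x t ht0 ht1 => ?_⟩
  rw [qPoly, eval_finsetSum, Finset.sum_mul]
  refine (Finset.abs_sum_le_sum_abs _ _).trans (Finset.sum_le_sum fun k hk => ?_)
  have hk2 := (Finset.mem_Icc.mp hk).1
  rw [eval_mul, eval_C, eval_pow, eval_X, abs_mul, abs_of_nonneg (pow_nonneg ht0 k)]
  exact mul_le_mul (hB k x) (pow_le_of_le_one ht0 ht1 (by omega)) (pow_nonneg ht0 k) (hB0 k)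

/-- The truncated expansion of the phase. -/
noncomputable def truncPhase (n : ℕ) (a y : ℝ) : ℝ :=
  a * y - Real.arctan y + ∑ s ∈ Finset.range (n - 1), L (s + 1) y / a ^ (s + 1)

/-- The successive derivatives of `arctan`. -/
noncomputable def arctanDeriv : ℕ → ℝ → ℝ
  | 0 => Real.arctan
  | j + 1 => iteratedDeriv j fun y : ℝ => 1 / (y ^ 2 + 1)

lemma hasDerivAt_arctanDeriv (j : ℕ) (x : ℝ) :
    HasDerivAt (arctanDeriv j) (arctanDeriv (j + 1) x) x := by
  rcases j with _ | j
  · simp only [arctanDeriv, iteratedDeriv_zero, add_comm (x ^ 2)]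
    exact Real.hasDerivAt_arctan x
  · exact hasDerivAt_iteratedDeriv re_p_mem j x

/-- The truncated expansion solves the truncated phase equation with a uniformly small error. -/
lemma exists_truncPhase_sub_le (n : ℕ) : ∃ K, 0 ≤ K ∧ ∀ a : ℝ, 1 ≤ a → ∀ x : ℝ,
    |truncPhase n a (x + (qPoly n x).eval a⁻¹) - (a * x - Real.arctan x)| ≤ K / a ^ n := by
  obtain ⟨K, hK, hres⟩ := exists_eval_residual_le n
  obtain ⟨B, hB, hq⟩ := exists_eval_qPoly_le n
  obtain ⟨D, hD, hu⟩ := exists_bound (iteratedDeriv_mem re_p_mem n)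
  choose M hM0 hM using fun s => exists_bound (iteratedDeriv_mem (L_mem s) (n + 1))
  refine ⟨K + D * B ^ (n + 1) + ∑ s ∈ Finset.range (n - 1), M s * B ^ (n + 1),
    add_nonneg (by positivity) (Finset.sum_nonneg fun s _ => mul_nonneg (hM0 s) (by positivity)),
    fun a ha x => ?_⟩
  have ha0 : 0 < a := by linarith
  set t := a⁻¹ with ht
  have ht0 : 0 ≤ t := by positivity
  have ht1 : t ≤ 1 := inv_le_one_of_one_le₀ ha
  set h := (qPoly n x).eval t with hh
  -- The displacement is O(t), so its power n + 1 is O(t^(n+1)); one factor t ≤ 1 is given away.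
  have hpow : |h| ^ (n + 1) ≤ B ^ (n + 1) * t ^ n := by
    calc |h| ^ (n + 1) ≤ (B * t) ^ (n + 1) := pow_le_pow_left₀ (abs_nonneg _) (hq x t ht0 ht1) _
      _ = B ^ (n + 1) * t ^ n * t := by ring
      _ ≤ B ^ (n + 1) * t ^ n * 1 := by gcongr
      _ = _ := mul_one _
  have hat : a * t = 1 := mul_inv_cancel₀ ha0.ne'
  have hah : a * h = ∑ k ∈ Finset.Icc 2 n, q k x * t ^ (k - 1) := by
    rw [hh, qPoly, eval_finsetSum, Finset.mul_sum]
    refine Finset.sum_congr rfl fun k hk => ?_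
    obtain ⟨k, rfl⟩ := Nat.exists_eq_succ_of_ne_zero
      (show k ≠ 0 by have := (Finset.mem_Icc.mp hk).1; omega)
    simp only [eval_mul, eval_C, eval_pow, eval_X, Nat.succ_sub_one, pow_succ]
    linear_combination q (k + 1) x * t ^ k * hat
  have heval : (residual n x).eval t = a * h
      - ∑ j ∈ Finset.range n, arctanDeriv (j + 1) x / (j + 1).factorial * h ^ (j + 1)
      + ∑ s ∈ Finset.range (n - 1), t ^ (s + 1) * ∑ j ∈ Finset.range (n + 1),
        iteratedDeriv j (L (s + 1)) x / j.factorial * h ^ j := by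
    rw [hah, residual]
    simp only [eval_add, eval_sub, eval_finsetSum, eval_mul, eval_C, eval_pow, eval_X, ← hh]
    rfl
  have hatan := abs_sub_taylor_le hasDerivAt_arctanDeriv hu (n := n + 1) x h
  rw [Finset.sum_range_succ'] at hatan
  simp only [arctanDeriv.eq_1, Nat.factorial_zero, Nat.cast_one, div_one, pow_zero,
    mul_one] at hatan
  have hLs : ∀ s, |L (s + 1) (x + h) - ∑ j ∈ Finset.range (n + 1),
      iteratedDeriv j (L (s + 1)) x / j.factorial * h ^ j| ≤ M s * |h| ^ (n + 1) := by
    intro s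
    have := abs_sub_taylor_le (fun j y => hasDerivAt_iteratedDeriv (L_mem s) j y) (hM s) x h
    simpa only [iteratedDeriv_zero] using this
  -- The error is the polynomial residual plus the Taylor remainders of arctan and of the L_s.
  have hsplit : truncPhase n a (x + h) - (a * x - Real.arctan x) = (residual n x).eval t
      - (Real.arctan (x + h) - (∑ j ∈ Finset.range n, arctanDeriv (j + 1) x
        / (j + 1).factorial * h ^ (j + 1) + Real.arctan x))
      + ∑ s ∈ Finset.range (n - 1), t ^ (s + 1) * (L (s + 1) (x + h)
        - ∑ j ∈ Finset.range (n + 1), iteratedDeriv j (L (s + 1)) x / j.factorial * h ^ j) := by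
    rw [heval, truncPhase]
    simp only [mul_sub, Finset.sum_sub_distrib]
    have : ∑ s ∈ Finset.range (n - 1), L (s + 1) (x + h) / a ^ (s + 1)
        = ∑ s ∈ Finset.range (n - 1), t ^ (s + 1) * L (s + 1) (x + h) := by
      refine Finset.sum_congr rfl fun s _ => ?_
      rw [ht, inv_pow, div_eq_inv_mul]
    rw [this]
    ring
  rw [hsplit, div_eq_mul_inv, ← inv_pow, ← ht, add_mul, add_mul, Finset.sum_mul]
  refine (abs_add_le _ _).trans (add_le_add ((abs_sub _ _).trans (add_le_add ?_ ?_)) ?_)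
  · exact hres x t ht0 ht1
  · refine hatan.trans ?_
    rw [mul_assoc]
    exact mul_le_mul_of_nonneg_left hpow hD
  · refine (Finset.abs_sum_le_sum_abs _ _).trans (Finset.sum_le_sum fun s _ => ?_)
    rw [abs_mul, abs_of_nonneg (pow_nonneg ht0 _), mul_assoc]
    calc t ^ (s + 1) * _ ≤ 1 * (M s * |h| ^ (n + 1)) :=
          mul_le_mul (pow_le_one₀ ht0 ht1) (hLs s) (abs_nonneg _) zero_le_one
      _ ≤ M s * (B ^ (n + 1) * t ^ n) := by
          rw [one_mul]
          exact mul_le_mul_of_nonneg_left hpow (hM0 s)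

/-- The derivatives of arctan and of the L_s are bounded, so for large a the term a y dominates. The
bound turns a small error in the equation into a small error in the solution. -/
lemma exists_truncPhase_mono (n : ℕ) : ∃ A : ℝ, ∀ a ≥ A, ∀ y z : ℝ,
    a / 2 * |y - z| ≤ |truncPhase n a y - truncPhase n a z| := by
  choose g hgm hg using fun s => exists_hasDerivAt (L_mem s)
  choose B hB0 hB using fun s => exists_bound (hgm s)
  refine ⟨max 1 (2 * (1 + ∑ s ∈ Finset.range (n - 1), B s)), fun a ha => ?_⟩
  have ha1 : 1 ≤ a := (le_max_left _ _).trans ha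
  have haB : 2 * (1 + ∑ s ∈ Finset.range (n - 1), B s) ≤ a := (le_max_right _ _).trans ha
  have hd : ∀ y, HasDerivAt (fun y => truncPhase n a y - a / 2 * y)
      (a * 1 - 1 / (1 + y ^ 2) + ∑ s ∈ Finset.range (n - 1), g s y / a ^ (s + 1) - a / 2 * 1) y :=
    fun y => ((((hasDerivAt_id y).const_mul a).sub (Real.hasDerivAt_arctan y)).add
      (HasDerivAt.fun_sum fun s _ => (hg s y).div_const _)).sub ((hasDerivAt_id y).const_mul (a / 2))
  have hmono : Monotone fun y => truncPhase n a y - a / 2 * y := by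
    refine monotone_of_deriv_nonneg (fun y => (hd y).differentiableAt) fun y => ?_
    rw [(hd y).deriv]
    have h1 : 1 / (1 + y ^ 2) ≤ 1 := by
      rw [div_le_one (by positivity)]; nlinarith [sq_nonneg y]
    have h2 : -∑ s ∈ Finset.range (n - 1), B s
        ≤ ∑ s ∈ Finset.range (n - 1), g s y / a ^ (s + 1) := by
      rw [← Finset.sum_neg_distrib]
      refine Finset.sum_le_sum fun s _ => (abs_le.mp ?_).1
      rw [abs_div, abs_of_pos (show 0 < a ^ (s + 1) by positivity)]
      exact (div_le_self (abs_nonneg _) (one_le_pow₀ ha1)).trans (hB s y)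
    linarith
  intro y z
  wlog hyz : z ≤ y generalizing y z
  · rw [abs_sub_comm, abs_sub_comm (truncPhase n a y)]
    exact this z y (le_of_not_ge hyz)
  have := hmono hyz
  rw [abs_of_nonneg (sub_nonneg.mpr hyz)]
  refine le_trans ?_ (le_abs_self _)
  simp only at this
  linarith

/-- Uniform expansion of a solution `θ` of `phase a θ = a x - arctan x`. -/
lemma exists_abs_sub_qPoly_le {n : ℕ} (hn : 0 < n) : ∃ K A : ℝ, ∀ a ≥ A, ∀ θ > 0, ∀ x : ℝ,
    phase a θ = a * x - Real.arctan x →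
      |θ - (x + (qPoly n x).eval a⁻¹)| ≤ K / a ^ (n + 1) := by
  obtain ⟨K₁, A₁, h₁⟩ := exists_phaseShift_expansion hn
  obtain ⟨K₂, hK₂, h₂⟩ := exists_truncPhase_sub_le n
  obtain ⟨A₃, h₃⟩ := exists_truncPhase_mono n
  obtain ⟨M, hM0, hM⟩ := exists_bound (L_mem (n - 1))
  refine ⟨2 * (|K₁| + M + K₂), max (max A₁ A₃) 1, fun a ha θ hθ x hx => ?_⟩
  have haA₁ : A₁ ≤ a := ((le_max_left _ _).trans (le_max_left _ _)).trans ha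
  have haA₃ : A₃ ≤ a := ((le_max_right _ _).trans (le_max_left _ _)).trans ha
  have ha1 : 1 ≤ a := (le_max_right _ _).trans ha
  have ha0 : 0 < a := by linarith
  -- `truncPhase` stops at L_(n-1), so the term L_n/a^n counts as error. Order a^(-n) suffices, as
  -- the slope a/2 supplies the missing power.
  have h4 : |phase a θ - truncPhase n a θ| ≤ (|K₁| + M) / a ^ n := by
    obtain ⟨n, rfl⟩ := Nat.exists_eq_succ_of_ne_zero hn.ne'
    have h5 := h₁ a haA₁ θ hθ
    rw [Finset.sum_range_succ] at h5
    have h6 : phase a θ - truncPhase n.succ a θ = (phaseShift a θ -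
        (∑ s ∈ Finset.range n, L (s + 1) θ / a ^ (s + 1) + L (n + 1) θ / a ^ (n + 1)))
        + L (n + 1) θ / a ^ (n + 1) := by
      rw [phase, truncPhase, Nat.succ_sub_one]
      ring
    rw [h6, add_div]
    refine (abs_add_le _ _).trans (add_le_add (h5.trans ?_) ?_)
    · calc K₁ / a ^ (n + 1 + 1) ≤ |K₁| / a ^ (n + 1 + 1) := by
            gcongr
            exact le_abs_self _
        _ ≤ |K₁| / a ^ (n + 1) := by
            gcongr
            omega
    · rw [abs_div, abs_of_pos (show 0 < a ^ (n + 1) by positivity)]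
      gcongr
      exact hM θ
  have h5 := h₂ a ha1 x
  have h6 := h₃ a haA₃ θ (x + (qPoly n x).eval a⁻¹)
  have h7 : |truncPhase n a θ - truncPhase n a (x + (qPoly n x).eval a⁻¹)|
      ≤ (|K₁| + M) / a ^ n + K₂ / a ^ n := by
    rw [← hx] at h5
    have h8 : truncPhase n a θ - truncPhase n a (x + (qPoly n x).eval a⁻¹)
      = -(phase a θ - truncPhase n a θ)
        - (truncPhase n a (x + (qPoly n x).eval a⁻¹) - phase a θ) := by ring
    rw [h8]
    refine (abs_sub _ _).trans (add_le_add ?_ h5)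
    rwa [abs_neg]
  have h8 := h6.trans h7
  rw [← add_div, le_div_iff₀ (by positivity)] at h8
  rw [le_div_iff₀ (by positivity), pow_succ]
  linarith

/-! ### Enumeration of the zeros. -/

/-- A function with derivative at least `c > 0` on `(0, ∞)` and limit `0` at `0` maps `(0, ∞)`
increasingly onto itself. -/
lemma bijective_of_deriv_ge {f : ℝ → ℝ} {c : ℝ} (hc : 0 < c)
    (h0 : Filter.Tendsto f (nhdsWithin 0 (Set.Ioi 0)) (nhds 0))
    (hf : ∀ θ > 0, ∃ d, c ≤ d ∧ HasDerivAt f d θ) :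
    StrictMonoOn f (Set.Ioi 0) ∧ (∀ θ > 0, 0 < f θ) ∧ ∀ μ > 0, ∃ θ > 0, f θ = μ := by
  have hcont : ContinuousOn f (Set.Ioi 0) := fun x hx => by
    obtain ⟨d, -, hd⟩ := hf x hx
    exact hd.continuousAt.continuousWithinAt
  have hmono : MonotoneOn (fun x => f x - c * x) (Set.Ioi 0) := by
    have hd : ∀ x > 0, ∃ d, 0 ≤ d ∧ HasDerivAt (fun x => f x - c * x) d x := by
      intro x hx
      obtain ⟨d, hcd, hd⟩ := hf x hx
      exact ⟨d - c * 1, by linarith, hd.sub ((hasDerivAt_id x).const_mul c)⟩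
    refine monotoneOn_of_deriv_nonneg (convex_Ioi 0) (hcont.sub (by fun_prop)) (fun x hx => ?_)
      fun x hx => ?_
    · rw [interior_Ioi] at hx
      obtain ⟨d, -, hd⟩ := hd x hx
      exact hd.differentiableAt.differentiableWithinAt
    · rw [interior_Ioi] at hx
      obtain ⟨d, hd0, hd⟩ := hd x hx
      rwa [hd.deriv]
  have hpos : ∀ θ > 0, c * θ ≤ f θ := by
    intro θ hθ
    have hlim : Filter.Tendsto (fun x => f x - c * x) (nhdsWithin 0 (Set.Ioi 0)) (nhds 0) := by
      have := ((continuous_const_mul c).tendsto 0).mono_left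
        (nhdsWithin_le_nhds (s := Set.Ioi 0))
      simpa using h0.sub this
    have := le_of_tendsto (b := f θ - c * θ) hlim ?_
    · linarith
    · filter_upwards [Ioo_mem_nhdsGT hθ] with x hx
      exact hmono hx.1 hθ hx.2.le
  refine ⟨fun x hx y hy hxy => ?_, fun θ hθ => (mul_pos hc hθ).trans_le (hpos θ hθ),
    fun μ hμ => ?_⟩
  · have := hmono hx hy hxy.le
    have := mul_lt_mul_of_pos_left hxy hc
    linarith
  · have hμc : 0 < μ / c := div_pos hμ hc
    obtain ⟨ε, hε1, hε2⟩ := ((h0.eventually_lt_const hμ).and (Ioo_mem_nhdsGT hμc)).exists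
    have h1 : μ ≤ f (μ / c) := by
      have := hpos _ hμc
      rwa [mul_div_cancel₀ μ hc.ne'] at this
    obtain ⟨θ, hθ, h⟩ := intermediate_value_Icc hε2.2.le
      (hcont.mono fun x hx => hε2.1.trans_le hx.1) ⟨hε1.le, h1⟩
    exact ⟨θ, hε2.1.trans_le hθ.1, h⟩

lemma mul_sub_arctan_properties {a : ℝ} (ha : 2 ≤ a) :
    StrictMonoOn (fun x => a * x - Real.arctan x) (Set.Ioi 0) ∧
      (∀ x > 0, 0 < a * x - Real.arctan x) ∧ ∀ μ > 0, ∃ x > 0, a * x - Real.arctan x = μ := by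
  refine bijective_of_deriv_ge one_pos ?_ fun x _ => ⟨_, ?_,
    ((hasDerivAt_id x).const_mul a).sub (Real.hasDerivAt_arctan x)⟩
  · have : Continuous fun x => a * x - Real.arctan x :=
      (continuous_const_mul a).sub Real.continuous_arctan
    simpa using (this.tendsto 0).mono_left (nhdsWithin_le_nhds (s := Set.Ioi 0))
  · have h1 : 1 / (1 + x ^ 2) ≤ 1 := by
      rw [div_le_one (by positivity)]; nlinarith [sq_nonneg x]
    linarith

/-- Expansion of the zeros of `Ti`, with the admissible values of the phase written as
`(m - 1 + β) π`, `m ≥ 1`, where `0 < β ≤ 1`. -/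
theorem hasUniformZeroExpansion_Ti {α β : ℝ} (l : ℤ) (hβ0 : 0 < β) (hβ1 : β ≤ 1)
    (hαβ : 1 / 2 + α = β + l) :
    HasUniformZeroExpansion (fun a θ => Ti a (a * θ) α)
      (fun m => ((m : ℝ) - 1 + β) * Real.pi) q := by
  obtain ⟨A, hA1, hA⟩ := exists_phase_properties
  set μ : ℕ → ℝ := fun m => ((m : ℝ) - 1 + β) * Real.pi with hμ
  have hμpos : ∀ m ≥ 1, 0 < μ m := by
    intro m hm
    have : (1 : ℝ) ≤ m := by exact_mod_cast hm
    exact mul_pos (by linarith) Real.pi_pos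
  have hμmono : StrictMono μ := by
    intro m m' h
    have : (m : ℝ) < m' := by exact_mod_cast h
    exact mul_lt_mul_of_pos_right (by linarith) Real.pi_pos
  have hphase : ∀ a ≥ max A 2, StrictMonoOn (phase a) (Set.Ioi 0) ∧ (∀ θ > 0, 0 < phase a θ) ∧
      ∀ μ > 0, ∃ θ > 0, phase a θ = μ := by
    intro a ha
    have haA : A ≤ a := (le_max_left _ _).trans ha
    exact bijective_of_deriv_ge (c := a / 2) (by linarith) (hA a haA).1
      fun θ hθ => ((hA a haA).2 θ hθ).2
  -- `epsilon` gives a total choice function; its values matter only where a solution exists.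
  set z : ℝ → ℕ → ℝ := fun a m => Classical.epsilon fun θ => 0 < θ ∧ phase a θ = μ m with hz
  set z₀ : ℝ → ℕ → ℝ :=
    fun a m => Classical.epsilon fun x => 0 < x ∧ a * x - Real.arctan x = μ m with hz₀
  have hzs : ∀ a ≥ max A 2, ∀ m ≥ 1, 0 < z a m ∧ phase a (z a m) = μ m := by
    intro a ha m hm
    obtain ⟨θ, hθ⟩ := (hphase a ha).2.2 (μ m) (hμpos m hm)
    exact Classical.epsilon_spec (p := fun θ => 0 < θ ∧ phase a θ = μ m) ⟨θ, hθ⟩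
  have hz₀s : ∀ a ≥ max A 2, ∀ m ≥ 1, 0 < z₀ a m ∧ a * z₀ a m - Real.arctan (z₀ a m) = μ m := by
    intro a ha m hm
    obtain ⟨x, hx⟩ := (mul_sub_arctan_properties ((le_max_right _ _).trans ha)).2.2 (μ m)
      (hμpos m hm)
    exact Classical.epsilon_spec (p := fun x => 0 < x ∧ a * x - Real.arctan x = μ m) ⟨x, hx⟩
  refine ⟨max A 2, z, z₀, fun a ha => ⟨?_, ?_⟩, fun a ha m hm => ?_, fun n hn => ?_⟩
  · intro m hm m' hm' h
    rw [← (hphase a ha).1.lt_iff_lt (hzs a ha m hm).1 (hzs a ha m' hm').1, (hzs a ha m hm).2,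
      (hzs a ha m' hm').2]
    exact hμmono h
  · have haA : A ≤ a := (le_max_left _ _).trans ha
    have ha0 : 0 < a := by linarith
    ext θ
    simp only [Set.mem_image, Set.mem_Ici, Set.mem_ofPred_eq]
    constructor
    · rintro ⟨m, hm, rfl⟩
      obtain ⟨h1, h2⟩ := hzs a ha m hm
      refine ⟨h1, (Ti_eq_zero_iff ha0 h1 ((hA a haA).2 _ h1).1).mpr ⟨m - 1 - l, ?_⟩⟩
      rw [h2, hμ]
      push_cast
      linear_combination (-Real.pi) * hαβ
    · rintro ⟨h1, h2⟩
      obtain ⟨k, hk⟩ := (Ti_eq_zero_iff ha0 h1 ((hA a haA).2 _ h1).1).mp h2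
      have h3 := (hphase a ha).2.1 θ h1
      have h4 : phase a θ = ((k + l : ℤ) + β) * Real.pi := by
        rw [hk]
        push_cast
        linear_combination Real.pi * hαβ
      -- Positivity of the phase excludes negative k + l because β ≤ 1. Thus k + l = m - 1 numbers
      -- the zeros from m = 1.
      have h5 : 0 ≤ k + l := by
        rw [h4] at h3
        have h6 := (mul_pos_iff_of_pos_right Real.pi_pos).mp h3
        have h7 : (-1 : ℝ) < (k + l : ℤ) := by linarith
        have : -1 < k + l := by exact_mod_cast h7
        omega
      obtain ⟨m, hm⟩ := Int.eq_ofNat_of_zero_le h5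
      refine ⟨m + 1, by omega, ?_⟩
      obtain ⟨h6, h7⟩ := hzs a ha (m + 1) (by omega)
      refine (hphase a ha).1.injOn h6 h1 ?_
      rw [h7, h4, hm, hμ]
      push_cast
      ring
  · obtain ⟨h1, h2⟩ := hz₀s a ha m hm
    ext x
    simp only [Set.mem_ofPred_eq, Set.mem_singleton_iff]
    refine ⟨fun h => ?_, fun h => h ▸ ⟨h1, h2⟩⟩
    exact (mul_sub_arctan_properties ((le_max_right _ _).trans ha)).1.injOn h.1 h1
      (h.2.trans h2.symm)
  · obtain ⟨K, A', h⟩ := exists_abs_sub_qPoly_le (show 0 < n from hn)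
    refine ⟨K, max (max A 2) A', fun a ha m hm => ?_⟩
    have ha1 := (le_max_left _ _).trans ha
    have ha2 := (le_max_right _ _).trans ha
    obtain ⟨h1, h2⟩ := hzs a ha1 m hm
    have h3 := h a ha2 (z a m) h1 (z₀ a m) (h2.trans (hz₀s a ha1 m hm).2.symm)
    rw [qPoly, eval_finsetSum] at h3
    simpa only [eval_mul, eval_C, eval_pow, eval_X, inv_pow, ← div_eq_mul_inv] using h3

lemma Ti_zero (a z : ℝ) : Ti a z 0 = Ci a z := by simp [Ti]

lemma Ti_half (a z : ℝ) : Ti a z (1 / 2) = Si a z := by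
  rw [Ti, mul_one_div, Real.cos_pi_div_two, Real.sin_pi_div_two]
  ring

end GTI

theorem mainTheorem3 :
    -- the coefficients are rational functions that vanish at `0` and at infinity
    (∀ k ≥ 2, ∃ P Q : Polynomial ℝ,
      (∀ x : ℝ, Q.eval x ≠ 0) ∧ ∀ x : ℝ, GTI.q k x = P.eval x / Q.eval x) ∧
    (∀ k ≥ 2, GTI.q k 0 = 0 ∧
      Filter.Tendsto (GTI.q k) (Filter.cocompact ℝ) (nhds 0)) ∧
    -- the first four coefficients
    (∀ x : ℝ, GTI.q 2 x = x * (x ^ 2 - 1) / (x ^ 2 + 1) ^ 2) ∧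
    (∀ x : ℝ, GTI.q 3 x = 4 * x ^ 3 * (2 * x ^ 2 - 3) / (x ^ 2 + 1) ^ 4) ∧
    (∀ x : ℝ, GTI.q 4 x =
      -(2 * x ^ 3 * (8 * x ^ 6 - 183 * x ^ 4 + 336 * x ^ 2 - 65)) / (3 * (x ^ 2 + 1) ^ 6)) ∧
    (∀ x : ℝ, GTI.q 5 x =
      -(x ^ 3 * (679 * x ^ 8 - 8384 * x ^ 6 + 17226 * x ^ 4 - 7168 * x ^ 2 + 431)) /
        (3 * (x ^ 2 + 1) ^ 8)) ∧
    -- the zeros of `Ci(a, aθ)`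
    GTI.HasUniformZeroExpansion (fun a θ => GTI.Ci a (a * θ))
      (fun m => ((m : ℝ) - 1 / 2) * Real.pi) GTI.q ∧
    -- the zeros of `Si(a, aθ)`
    GTI.HasUniformZeroExpansion (fun a θ => GTI.Si a (a * θ))
      (fun m => (m : ℝ) * Real.pi) GTI.q ∧
    -- the zeros of `Ti(a, aθ, α)`, where `l = 0` for `0 ≤ α ≤ 1/2` and `l = 1` for `1/2 < α < 1`
    (∀ α : ℝ, 0 ≤ α → α ≤ 1 / 2 →
      GTI.HasUniformZeroExpansion (fun a θ => GTI.Ti a (a * θ) α)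
        (fun m => ((m : ℝ) + α - 1 / 2) * Real.pi) GTI.q) ∧
    (∀ α : ℝ, 1 / 2 < α → α < 1 →
      GTI.HasUniformZeroExpansion (fun a θ => GTI.Ti a (a * θ) α)
        (fun m => ((m : ℝ) - 1 + α - 1 / 2) * Real.pi) GTI.q) := by
  refine ⟨fun k _ => ?_, fun k _ => ⟨GTI.q_zero_right k, GTI.tendsto_q_cocompact k⟩, GTI.q_two,
    GTI.q_three, GTI.q_four, GTI.q_five, ?_, ?_, fun α h0 h1 => ?_, fun α h0 h1 => ?_⟩
  · obtain ⟨P, n, h⟩ := GTI.exists_eq_div (GTI.q_mem k)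
    refine ⟨P, (Polynomial.X ^ 2 + 1) ^ n, fun x => ?_, fun x => ?_⟩
    · simp only [Polynomial.eval_pow, Polynomial.eval_add, Polynomial.eval_X, Polynomial.eval_one]
      positivity
    · rw [h]
      simp
  · have h := GTI.hasUniformZeroExpansion_Ti (α := 0) (β := 1 / 2) 0 (by norm_num) (by norm_num)
      (by norm_num)
    convert h using 3 with a m
    · rw [GTI.Ti_zero]
    · ring
  · have h := GTI.hasUniformZeroExpansion_Ti (α := 1 / 2) (β := 1) 0 (by norm_num) (by norm_num)
      (by norm_num)
    convert h using 3 with a m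
    · rw [GTI.Ti_half]
    · ring
  · have h := GTI.hasUniformZeroExpansion_Ti (α := α) (β := α + 1 / 2) 0 (by linarith)
      (by linarith) (by push_cast; ring)
    convert h using 3 with m
    ring
  -- For α > 1/2 the shift 1/2 + α exceeds 1. Taking l = 1 brings β back into (0, 1], since the
  -- additional phase value (α - 1/2)π is already positive.
  · have h := GTI.hasUniformZeroExpansion_Ti (α := α) (β := α - 1 / 2) 1 (by linarith)
      (by linarith) (by push_cast; ring)
    convert h using 3 with m
    ring
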